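/- A \emph{pentagram} is the union of the five diagonals of a strictly convex pentagon, and a \emph{hexagram} is the union of the two triangles $p_0p_2p_4$ and $p_1p_3p_5$ formed from the vertices $p_0,\dots,p_5$, in cyclic order, of a strictly convex hexagon; it is \emph{regular} if the vertices are $5$ (respectively $6$) equally spaced points of a circle. The number of regions formed by finitely many such figures is the number of connected components of the complement of their union in the plane. (1) Every pentagram has exactly $5$ self-crossings (points interior to two different segments of it), and two pentagrams with only finitely many common points meet in at most $20$ points. (2) For every integer $n\ge 1$, the maximum number of regions formed by $n$ pentagrams is $10n^2-5n+2$, and the maximum number of regions formed by $n$ hexagrams is $2(6n^2-3n+1)$. Here the figures may be of different sizes, shapes and positions; both maxima are the same if only regular figures are allowed. (3) The bounds are attained by regular stars on equally spaced points of a circle: let $n \ge 1$, let $m=5$ (pentagrams) or $m=6$ (hexagrams), take any $mn$ equally spaced points of a circle of positive radius, numbered consecutively $0,\dots,mn-1$, and for each $k=0,\dots,n-1$ draw the star whose vertices are the $m$ points with number congruent to $k$ modulo $n$. These $n$ stars are regular, and they form exactly $10n^2-5n+2$ regions if $m=5$ and exactly $2(6n^2-3n+1)$ regions if $m=6$. For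 $m=5$, any two different ones of the $n$ pentagrams meet in exactly $20$ points. -/

import Mathlib

open Complex

noncomputable section

namespace StarRegions

/-- Twice the signed area of the triangle `a b c` in the Euclidean plane `ℂ`; it is positive
exactly when `a, b, c` is a counterclockwise, non-degenerate triangle. -/
def orient (a b c : ℂ) : ℝ :=
  (b.re - a.re) * (c.im - a.im) - (b.im - a.im) * (c.re - a.re)

/-- `p 0, …, p (m - 1)` are the vertices of a strictly convex `m`-gon, listed counterclockwise. -/
def IsConvexPolygon {m : ℕ} (p : Fin m → ℂ) : Prop :=
  ∀ i j k : Fin m, i < j → j < k → 0 < orient (p i) (p j) (p k)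

/-- The `j`-th of `N` equally spaced points on the circle with centre `c` and radius `‖ρ‖`, the
point number `0` being `c + ρ`. -/
def circlePoint (c ρ : ℂ) (N j : ℕ) : ℂ :=
  c + ρ * Complex.exp (2 * Real.pi * Complex.I * (j / N))

/-- `p 0, …, p (m - 1)` are `m` equally spaced points around a circle of positive radius, listed
counterclockwise. -/
def IsRegularPolygon {m : ℕ} (p : Fin m → ℂ) : Prop :=
  ∃ c ρ : ℂ, ρ ≠ 0 ∧ ∀ j : Fin m, p j = circlePoint c ρ m j

/-- The point set of the star polygon that joins each of the points `p 0, …, p (m - 1)` to the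
second next one (indices modulo `m`). For `m = 5` it is one closed chain of five segments, for
`m = 6` it consists of the two triangles `p 0, p 2, p 4` and `p 1, p 3, p 5`. -/
def star {m : ℕ} [NeZero m] (p : Fin m → ℂ) : Set ℂ :=
  ⋃ j : Fin m, segment ℝ (p j) (p (j + 2))

/-- The self-crossings of `star p`: the points interior to two different segments of it. -/
def selfCrossings {m : ℕ} [NeZero m] (p : Fin m → ℂ) : Set ℂ :=
  {x | ∃ i j : Fin m, i ≠ j ∧
    x ∈ openSegment ℝ (p i) (p (i + 2)) ∧ x ∈ openSegment ℝ (p j) (p (j + 2))}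

/-- A pentagram, regular or not. -/
def IsPentagram (S : Set ℂ) : Prop :=
  ∃ p : Fin 5 → ℂ, IsConvexPolygon p ∧ S = star p

/-- A regular pentagram. -/
def IsRegularPentagram (S : Set ℂ) : Prop :=
  ∃ p : Fin 5 → ℂ, IsRegularPolygon p ∧ S = star p

/-- A hexagram, regular or not. -/
def IsHexagram (S : Set ℂ) : Prop :=
  ∃ p : Fin 6 → ℂ, IsConvexPolygon p ∧ S = star p

/-- A regular hexagram. -/
def IsRegularHexagram (S : Set ℂ) : Prop :=
  ∃ p : Fin 6 → ℂ, IsRegularPolygon p ∧ S = star p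

/-- The number (possibly infinite) of regions into which a finite family of figures divides the
plane, that is, of connected components of the complement of their union. -/
def numRegions {n : ℕ} (S : Fin n → Set ℂ) : ℕ∞ :=
  ENat.card (ConnectedComponents ↥((⋃ i, S i)ᶜ : Set ℂ))

/-- The numbers of regions that can be formed by drawing `n` figures of the given kind. -/
def regionCounts (Shape : Set ℂ → Prop) (n : ℕ) : Set ℕ∞ :=
  {R | ∃ S : Fin n → Set ℂ, (∀ i, Shape (S i)) ∧ R = numRegions S}

/-- The `n` stars based on `m * n` equally spaced points of a circle: the star number `k` uses the
points whose number is congruent to `k` modulo `n`. -/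
def circleStars (m : ℕ) [NeZero m] (c ρ : ℂ) (n : ℕ) (k : Fin n) : Set ℂ :=
  star fun j : Fin m => circlePoint c ρ (m * n) (k + n * j)

end StarRegions

end

/-! Upper bound. Draw the stars edge by edge. If an edge meets the drawing in k ≥ 1 closed convex
pieces, there are at most k - 1 gaps between consecutive pieces; filling a gap splits at most one
region in two, and the loose ends split nothing (`numComp_union_segment`). Counting pieces instead
of points covers overlapping edges as well, so no general position is needed.

A line crosses a closed chain with an odd number of sides an even number of times. Hence a segment
meets a pentagram in at most 4 pieces and a triangle in at most 2 (`Pieces.star_of_odd`), so a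
hexagram, being two triangles, in at most 4. Each segment drawn earlier in the same star contributes
at most one more piece. On top of n ≥ 1 stars, a pentagram therefore adds at most (4n-1) + 4n + ...
+ (4n+3) = 20n + 5 regions, and a hexagram at most (4n-1) + 4n + (4n+1) + (4n+1) + (4n+2) + (4n+3) =
24n + 6. A single star has at most 7, respectively 8, regions, and summation gives the formulas. The
bound 20 for two pentagrams is five segments times four pieces, each piece being a point.

Lower bound. Normalise to the unit circle and put N = m * n. The chords lie on lines at one common
distance from the centre. Label a point by the set of chord lines that separate it from the centre.
Outside the disc the lines go on where the chords have stopped, so all labels with 2n consecutive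
members, which include those of all points outside the disc, are identified; the label is then
locally constant off the stars (`isLocallyConstant_regionLabel`). The points `gridPoint` realise
every cyclic run of l consecutive chords with 1 ≤ l ≤ 2n - 1. With the centre and the exterior this
gives N(2n-1) + 2 different labels, which is the upper bound for m = 5 and m = 6. -/

namespace StarRegions

open Set Filter Topology

/-! ### Counting the components of the complement of a closed set -/

/-- The number of connected components of the complement of `K`. -/
noncomputable def numComp (K : Set ℂ) : ℕ∞ :=
  ENat.card (ConnectedComponents ↥(Kᶜ : Set ℂ))

theorem mk_eq_of_isPreconnected {V N : Set ℂ} (hN : IsPreconnected N) (hNV : N ⊆ V)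
    {x y : ↥V} (hx : x.1 ∈ N) (hy : y.1 ∈ N) :
    ConnectedComponents.mk x = ConnectedComponents.mk y := by
  rw [ConnectedComponents.coe_eq_coe']
  have h : IsPreconnected ((↑) ⁻¹' N : Set ↥V) := by
    rw [← Topology.IsInducing.subtypeVal.isPreconnected_image, Subtype.image_preimage_coe,
      inter_eq_right.2 hNV]
    exact hN
  exact h.subset_connectedComponent hy hx

/-- Components of the open set V are open, and the points of U outside V are near c₁ and c₂ only.
Any other component c is thus clopen in U, and nothing merges with it in passing from V to U. -/
theorem mk_eq_of_map_eq {U V : Set ℂ} (hV : IsOpen V) (hVU : V ⊆ U)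
    {c₁ c₂ : ConnectedComponents ↥V}
    (h : ∀ x ∈ U, x ∉ V → ∀ᶠ y in 𝓝 x, ∀ hy : y ∈ V,
      ConnectedComponents.mk (⟨y, hy⟩ : ↥V) = c₁ ∨ ConnectedComponents.mk (⟨y, hy⟩ : ↥V) = c₂)
    {c c' : ConnectedComponents ↥V} (hc₁ : c ≠ c₁) (hc₂ : c ≠ c₂)
    (hcc : (continuous_inclusion hVU).connectedComponentsMap c =
      (continuous_inclusion hVU).connectedComponentsMap c') : c' = c := by
  have hlc : LocallyConnectedSpace ↥V := hV.locallyConnectedSpace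
  have hopen : ∀ s : Set (ConnectedComponents ↥V),
      IsOpen {y : ℂ | ∃ hy : y ∈ V, ConnectedComponents.mk (⟨y, hy⟩ : ↥V) ∈ s} := by
    intro s
    have h1 : IsOpen (ConnectedComponents.mk ⁻¹' s : Set ↥V) :=
      (isOpen_discrete s).preimage ConnectedComponents.continuous_coe
    convert hV.isOpenMap_subtype_val _ h1 using 1
    ext y
    simp
  obtain ⟨v, rfl⟩ := ConnectedComponents.surjective_coe c
  obtain ⟨v', rfl⟩ := ConnectedComponents.surjective_coe c'
  set D : Set ↥U := {u | ∃ hu : u.1 ∈ V, ConnectedComponents.mk (⟨u.1, hu⟩ : ↥V) ∈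
    ({ConnectedComponents.mk v} : Set (ConnectedComponents ↥V))} with hD
  have hclopen : IsClopen D := by
    refine ⟨⟨?_⟩, (hopen _).preimage continuous_subtype_val⟩
    rw [isOpen_iff_mem_nhds]
    intro u hu
    by_cases huV : u.1 ∈ V
    · have h2 := ((hopen {ConnectedComponents.mk v}ᶜ).preimage
        (continuous_subtype_val (p := (· ∈ U)))).mem_nhds (x := u)
          ⟨huV, fun h3 => hu ⟨huV, h3⟩⟩
      filter_upwards [h2] with w hw
      obtain ⟨hw1, hw2⟩ := hw
      rintro ⟨_, hw4⟩
      exact hw2 hw4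
    · have h2 := (continuous_subtype_val (p := (· ∈ U))).continuousAt.eventually (h u.1 u.2 huV)
      filter_upwards [h2] with w hw
      rintro ⟨hw1, hw2⟩
      rw [mem_singleton_iff] at hw2
      rcases hw hw1 with h3 | h3
      · exact hc₁ (hw2.symm.trans h3)
      · exact hc₂ (hw2.symm.trans h3)
  have hmem : inclusion hVU v' ∈ connectedComponent (inclusion hVU v) := by
    rw [← ConnectedComponents.coe_eq_coe']
    exact hcc.symm
  obtain ⟨h1, h2⟩ := hclopen.connectedComponent_subset
    (x := inclusion hVU v) ⟨v.2, rfl⟩ hmem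
  exact h2

/-- At most the two components c₁ and c₂ can merge, so the map on components is injective once c₂ is
discarded. -/
theorem card_components_le_add_one {U V : Set ℂ} (hV : IsOpen V) (hVU : V ⊆ U)
    {c₁ c₂ : ConnectedComponents ↥V}
    (h : ∀ x ∈ U, x ∉ V → ∀ᶠ y in 𝓝 x, ∀ hy : y ∈ V,
      ConnectedComponents.mk (⟨y, hy⟩ : ↥V) = c₁ ∨ ConnectedComponents.mk (⟨y, hy⟩ : ↥V) = c₂) :
    ENat.card (ConnectedComponents ↥V) ≤ ENat.card (ConnectedComponents ↥U) + 1 := by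
  rw [← encard_univ, ← encard_univ, ← encard_sdiff_singleton_add_one (mem_univ c₂)]
  gcongr
  have hinj : InjOn (continuous_inclusion hVU).connectedComponentsMap (univ \ {c₂}) := by
    intro c hc c' hc' hcc
    by_cases h1 : c = c₁
    · by_cases h2 : c' = c₁
      · rw [h1, h2]
      · exact mk_eq_of_map_eq hV hVU h h2 hc'.2 hcc.symm
    · exact (mk_eq_of_map_eq hV hVU h h1 hc.2 hcc).symm
  rw [← hinj.encard_image]
  exact encard_le_encard (subset_univ _)

theorem card_components_le {U V : Set ℂ} (hV : IsOpen V) (hVU : V ⊆ U)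
    {c : ConnectedComponents ↥V}
    (h : ∀ x ∈ U, x ∉ V → ∀ᶠ y in 𝓝 x, ∀ hy : y ∈ V,
      ConnectedComponents.mk (⟨y, hy⟩ : ↥V) = c) :
    ENat.card (ConnectedComponents ↥V) ≤ ENat.card (ConnectedComponents ↥U) := by
  have h' : ∀ x ∈ U, x ∉ V → ∀ᶠ y in 𝓝 x, ∀ hy : y ∈ V,
      ConnectedComponents.mk (⟨y, hy⟩ : ↥V) = c ∨ ConnectedComponents.mk (⟨y, hy⟩ : ↥V) = c :=
    fun x hx hx' => (h x hx hx').mono fun y hy hyV => Or.inl (hy hyV)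
  have hinj : Function.Injective (continuous_inclusion hVU).connectedComponentsMap := by
    intro c₁ c₂ hcc
    by_cases h1 : c₁ = c
    · by_cases h2 : c₂ = c
      · rw [h1, h2]
      · exact mk_eq_of_map_eq hV hVU h' h2 h2 hcc.symm
    · exact (mk_eq_of_map_eq hV hVU h' h1 h1 hcc).symm
  exact ENat.card_le_card_of_injective hinj

/-- N₁ and N₂ play the two banks of the new curve L; being connected, each lies in a single
component of the new complement. -/
theorem numComp_le_add_one_of_isPreconnected {K L N₁ N₂ : Set ℂ} (hKL : IsClosed (K ∪ L))
    (h₁ : IsPreconnected N₁) (h₂ : IsPreconnected N₂) (hn₁ : N₁.Nonempty) (hn₂ : N₂.Nonempty)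
    (hd₁ : N₁ ⊆ (K ∪ L)ᶜ) (hd₂ : N₂ ⊆ (K ∪ L)ᶜ)
    (h : ∀ x ∈ L, x ∉ K → ∀ᶠ y in 𝓝 x, y ∈ L ∨ y ∈ N₁ ∨ y ∈ N₂) :
    numComp (K ∪ L) ≤ numComp K + 1 := by
  obtain ⟨n₁, hn₁⟩ := hn₁
  obtain ⟨n₂, hn₂⟩ := hn₂
  refine card_components_le_add_one hKL.isOpen_compl
    (compl_subset_compl.2 subset_union_left)
    (c₁ := ConnectedComponents.mk ⟨n₁, hd₁ hn₁⟩) (c₂ := ConnectedComponents.mk ⟨n₂, hd₂ hn₂⟩) ?_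
  intro x hxK hxV
  have hxL : x ∈ L := by
    by_contra hxL
    exact hxV fun h' => h'.elim hxK hxL
  filter_upwards [h x hxL hxK] with y hy hyV
  rcases hy with hy | hy | hy
  · exact absurd (Or.inr hy) hyV
  · exact Or.inl (mk_eq_of_isPreconnected h₁ hd₁ hy hn₁)
  · exact Or.inr (mk_eq_of_isPreconnected h₂ hd₂ hy hn₂)

theorem numComp_le_of_isPreconnected {K L N : Set ℂ} (hKL : IsClosed (K ∪ L))
    (hN : IsPreconnected N) (hn : N.Nonempty) (hd : N ⊆ (K ∪ L)ᶜ)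
    (h : ∀ x ∈ L, x ∉ K → ∀ᶠ y in 𝓝 x, y ∈ L ∨ y ∈ N) :
    numComp (K ∪ L) ≤ numComp K := by
  obtain ⟨n, hn⟩ := hn
  refine card_components_le hKL.isOpen_compl (compl_subset_compl.2 subset_union_left)
    (c := ConnectedComponents.mk ⟨n, hd hn⟩) ?_
  intro x hxK hxV
  have hxL : x ∈ L := by
    by_contra hxL
    exact hxV fun h' => h'.elim hxK hxL
  filter_upwards [h x hxL hxK] with y hy hyV
  rcases hy with hy | hy
  · exact absurd (Or.inr hy) hyV
  · exact mk_eq_of_isPreconnected hN hd hy hn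

theorem numComp_empty_le : numComp ∅ ≤ 1 := by
  have h1 : Subsingleton (ConnectedComponents ↥((∅ : Set ℂ)ᶜ)) := by
    refine ⟨fun a b => ?_⟩
    obtain ⟨v, rfl⟩ := ConnectedComponents.surjective_coe a
    obtain ⟨w, rfl⟩ := ConnectedComponents.surjective_coe b
    exact mk_eq_of_isPreconnected isPreconnected_univ (by simp) (mem_univ _) (mem_univ _)
  exact ENat.card_le_one

/-! ### Adding one edge -/

/-- The part over the parameters in `J` of the tube on one side (`σ = 1` or `σ = -1`) of the line
`u ↦ a + u * v`, as wide as the closed set `K` permits. -/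
def sideTube (K : Set ℂ) (a v : ℂ) (J : Set ℝ) (σ : ℝ) : Set ℂ :=
  (fun q : ℝ × ℝ => a + (q.1 + (σ * q.2 * (Metric.infDist (a + q.1 * v) K / ‖v‖) : ℝ) * I) * v) ''
    (J ×ˢ Ioo 0 1)

theorem sideTube_isPreconnected (K : Set ℂ) (a v : ℂ) {J : Set ℝ} (hJ : IsPreconnected J) (σ : ℝ) :
    IsPreconnected (sideTube K a v J σ) := by
  refine (hJ.prod isPreconnected_Ioo).image _ (Continuous.continuousOn ?_)
  have h : Continuous fun q : ℝ × ℝ => Metric.infDist (a + q.1 * v) K :=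
    (Metric.continuous_infDist_pt K).comp (by fun_prop)
  fun_prop

theorem sideTube_nonempty (K : Set ℂ) (a v : ℂ) {J : Set ℝ} (hJ : J.Nonempty) (σ : ℝ) :
    (sideTube K a v J σ).Nonempty :=
  (hJ.prod ⟨1 / 2, by norm_num⟩).image _

theorem line_injective {a v : ℂ} (hv : v ≠ 0) {z w : ℂ} (h : a + z * v = a + w * v) : z = w :=
  mul_right_cancel₀ hv (add_left_cancel h)

/-- A point of the tube is closer to its foot on the line than `K` is, and its nonzero offset keeps
it off the line. -/
theorem sideTube_subset {K : Set ℂ} (hK : IsClosed K) (hne : K.Nonempty) {a v : ℂ} (hv : v ≠ 0)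
    {J : Set ℝ} (hJ : ∀ u ∈ J, a + u * v ∉ K) {σ : ℝ} (hσ : |σ| = 1) (T : Set ℝ) :
    sideTube K a v J σ ⊆ (K ∪ (fun u : ℝ => a + u * v) '' T)ᶜ := by
  rintro _ ⟨⟨u, r⟩, ⟨hu, hr⟩, rfl⟩
  simp only at hu hr ⊢
  have hv' : 0 < ‖v‖ := norm_pos_iff.2 hv
  have hpos : 0 < Metric.infDist (a + u * v) K := (hK.notMem_iff_infDist_pos hne).1 (hJ u hu)
  set δ := Metric.infDist (a + u * v) K with hδ
  rintro (h | ⟨w, -, h⟩)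
  · refine Metric.notMem_of_dist_lt_infDist (x := a + u * v) ?_ h
    rw [dist_eq_norm]
    have : a + u * v - (a + (u + (σ * r * (δ / ‖v‖) : ℝ) * I) * v) =
        -((σ * r * (δ / ‖v‖) : ℝ) * I * v) := by ring
    rw [this, norm_neg, norm_mul, norm_mul, norm_I, norm_real, Real.norm_eq_abs, abs_mul, abs_mul,
      hσ, abs_of_pos hr.1, abs_of_pos (div_pos hpos hv')]
    have : 1 * r * (δ / ‖v‖) * 1 * ‖v‖ = r * δ := by field_simp
    rw [this]
    nlinarith [hr.2]
  · have h1 := congrArg Complex.im (line_injective hv h)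
    simp at h1
    rcases h1 with (h1 | h1) | h1 | h1
    · rw [h1] at hσ; simp at hσ
    · exact hr.1.ne' h1
    · exact hpos.ne' h1
    · exact hv h1

/-- In the coordinate z = (y - a) / v the width of the tubes is continuous and positive at u, so |im
z| falls below it near u. The sign of im z selects the line or a tube. -/
theorem eventually_mem_sideTube {K : Set ℂ} (hK : IsClosed K) (hne : K.Nonempty) {a v : ℂ}
    (hv : v ≠ 0) {J T : Set ℝ} (hJT : J ⊆ T) {u : ℝ} (hu : J ∈ 𝓝 u) (huK : a + u * v ∉ K) :
    ∀ᶠ y in 𝓝 (a + u * v), y ∈ (fun u : ℝ => a + u * v) '' T ∨ y ∈ sideTube K a v J 1 ∨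
      y ∈ sideTube K a v J (-1) := by
  have hv' : 0 < ‖v‖ := norm_pos_iff.2 hv
  have hz : Tendsto (fun y : ℂ => (y - a) / v) (𝓝 (a + u * v)) (𝓝 (u : ℂ)) := by
    have : Continuous fun y : ℂ => (y - a) / v := by fun_prop
    convert this.tendsto (a + u * v) using 2
    field_simp; ring
  have h1 : ∀ᶠ z : ℂ in 𝓝 (u : ℂ), z.re ∈ J :=
    Complex.continuous_re.continuousAt.eventually (by simpa using hu)
  have hcont : Continuous fun z : ℂ => Metric.infDist (a + (z.re : ℂ) * v) K / ‖v‖ - |z.im| := by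
    have h : Continuous fun z : ℂ => Metric.infDist (a + (z.re : ℂ) * v) K :=
      (Metric.continuous_infDist_pt K).comp (by fun_prop)
    fun_prop
  have h2 : ∀ᶠ z : ℂ in 𝓝 (u : ℂ),
      0 < Metric.infDist (a + (z.re : ℂ) * v) K / ‖v‖ - |z.im| := by
    refine hcont.continuousAt.eventually (lt_mem_nhds ?_)
    simpa using div_pos ((hK.notMem_iff_infDist_pos hne).1 huK) hv'
  filter_upwards [hz.eventually h1, hz.eventually h2] with y hy1 hy2
  obtain ⟨z, rfl⟩ : ∃ z : ℂ, y = a + z * v := ⟨(y - a) / v, by field_simp; ring⟩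
  have hzz : (a + z * v - a) / v = z := by field_simp; ring
  rw [hzz] at hy1 hy2
  set δ := Metric.infDist (a + (z.re : ℂ) * v) K / ‖v‖ with hδ
  have key : ∀ σ : ℝ, |σ| = 1 → 0 < σ * z.im → a + z * v ∈ sideTube K a v J σ := by
    intro σ hσ hpos
    have habs : |z.im| = σ * z.im := by
      rw [← abs_of_pos hpos, abs_mul, hσ, one_mul]
    have hδ0 : 0 < δ := by linarith [abs_nonneg z.im]
    refine ⟨(z.re, σ * z.im / δ), ⟨hy1, div_pos hpos hδ0, ?_⟩, ?_⟩
    · rw [div_lt_one hδ0]; linarith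
    · simp only
      rw [← hδ]
      have : σ * (σ * z.im / δ) * δ = z.im := by
        have h3 : σ * σ = 1 := by rw [← abs_mul_abs_self, hσ, one_mul]
        field_simp
        linear_combination z.im * h3
      rw [this, Complex.re_add_im]
  rcases lt_trichotomy z.im 0 with h | h | h
  · exact Or.inr (Or.inr (key (-1) (by simp) (by linarith)))
  · refine Or.inl ⟨z.re, hJT hy1, ?_⟩
    simp only
    congr 2
    apply Complex.ext <;> simp [h]
  · exact Or.inr (Or.inl (key 1 (by simp) (by linarith)))

theorem isClosed_image_line (a v : ℂ) (s t : ℝ) :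
    IsClosed ((fun u : ℝ => a + u * v) '' Icc s t) :=
  (isCompact_Icc.image (by fun_prop)).isClosed

/-- Each bank of the edge is one connected tube, so at most two components touch the new edge. -/
theorem numComp_closing_edge {K : Set ℂ} (hK : IsClosed K) {a v : ℂ} (hv : v ≠ 0) {s t : ℝ}
    (hst : s < t) (hs : a + s * v ∈ K) (ht : a + t * v ∈ K)
    (h : ∀ u ∈ Ioo s t, a + u * v ∉ K) :
    numComp (K ∪ (fun u : ℝ => a + u * v) '' Icc s t) ≤ numComp K + 1 := by
  have hne : (Ioo s t).Nonempty := nonempty_Ioo.2 hst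
  refine numComp_le_add_one_of_isPreconnected (hK.union (isClosed_image_line a v s t))
    (sideTube_isPreconnected K a v isPreconnected_Ioo 1)
    (sideTube_isPreconnected K a v isPreconnected_Ioo (-1))
    (sideTube_nonempty K a v hne 1) (sideTube_nonempty K a v hne (-1))
    (sideTube_subset hK ⟨_, hs⟩ hv h (by simp) _) (sideTube_subset hK ⟨_, hs⟩ hv h (by simp) _) ?_
  rintro _ ⟨u, hu, rfl⟩ hxK
  simp only at hxK
  have hu' : u ∈ Ioo s t := by
    refine ⟨lt_of_le_of_ne hu.1 ?_, lt_of_le_of_ne hu.2 ?_⟩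
    · rintro rfl; exact hxK hs
    · rintro rfl; exact hxK ht
  exact eventually_mem_sideTube hK ⟨_, hs⟩ hv Ioo_subset_Icc_self (Ioo_mem_nhds hu'.1 hu'.2) hxK

/-- A disc without the radius pointing to the left. -/
def slitDisc (r : ℝ) : Set ℂ := slitPlane ∩ Metric.ball 0 r

/-- The slit disc is star-shaped about r / 2. -/
theorem slitDisc_isPreconnected {r : ℝ} (hr : 0 < r) : IsPreconnected (slitDisc r) := by
  have h1 : StarConvex ℝ ((r / 2 : ℝ) : ℂ) slitPlane := by
    intro y hy α β hα hβ hαβ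
    rw [mem_slitPlane_iff] at hy ⊢
    rcases hβ.eq_or_lt with rfl | hβ
    · left
      have : α = 1 := by linarith
      simp [this, hr]
    · rcases hy with hy | hy
      · left
        simp only [add_re, real_smul, mul_re, ofReal_re, ofReal_im, zero_mul, sub_zero]
        have := mul_pos hβ hy
        positivity
      · right
        simp [hβ.ne', hy]
  have hm : ((r / 2 : ℝ) : ℂ) ∈ Metric.ball (0 : ℂ) r := by
    rw [mem_ball_zero_iff, norm_real, Real.norm_eq_abs, abs_of_pos (by positivity)]
    linarith
  have h2 : StarConvex ℝ ((r / 2 : ℝ) : ℂ) (Metric.ball (0 : ℂ) r) :=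
    (convex_ball 0 r).starConvex hm
  refine (StarConvex.isPathConnected (h1.inter h2) ⟨?_, hm⟩).isConnected.isPreconnected
  rw [mem_slitPlane_iff]
  left
  simpa using hr

/-- A pendant edge separates nothing: a slit disc around its free end joins the tubes on both banks
into one connected set. -/
theorem numComp_free_edge {K : Set ℂ} (hK : IsClosed K) {a v : ℂ} (hv : v ≠ 0) {s t : ℝ}
    (hst : s < t) (hs : a + s * v ∈ K) (h : ∀ u ∈ Ioc s t, a + u * v ∉ K) :
    numComp (K ∪ (fun u : ℝ => a + u * v) '' Icc s t) ≤ numComp K := by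
  have hv' : 0 < ‖v‖ := norm_pos_iff.2 hv
  have htt : t ∈ Ioc s t := ⟨hst, le_rfl⟩
  have htK := h t htt
  have hpos : 0 < Metric.infDist (a + t * v) K :=
    (hK.notMem_iff_infDist_pos ⟨_, hs⟩).1 htK
  set δ := Metric.infDist (a + t * v) K / ‖v‖ with hδ
  have hδ0 : 0 < δ := div_pos hpos hv'
  set D : Set ℂ := (fun z : ℂ => a + (t + z) * v) '' slitDisc δ with hD
  have hDc : IsPreconnected D :=
    (slitDisc_isPreconnected hδ0).image _ (Continuous.continuousOn (by fun_prop))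
  -- One point of each tube, over the free end at half the width, also lies in the slit disc; there
  -- the three sets are glued.
  have hmem : ∀ σ : ℝ, |σ| = 1 → a + (t + (σ * (1 / 2) * δ : ℝ) * I) * v ∈ D ∧
      a + (t + (σ * (1 / 2) * δ : ℝ) * I) * v ∈ sideTube K a v (Ioc s t) σ := by
    intro σ hσ
    refine ⟨⟨(σ * (1 / 2) * δ : ℝ) * I, ⟨?_, ?_⟩, rfl⟩, ⟨(t, 1 / 2), ⟨htt, by norm_num⟩, rfl⟩⟩
    · rw [mem_slitPlane_iff]
      right
      have : σ ≠ 0 := by rintro rfl; simp at hσ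
      simp [this, hδ0.ne']
    · rw [mem_ball_zero_iff, norm_mul, norm_I, norm_real, Real.norm_eq_abs, abs_mul, abs_mul, hσ,
        abs_of_pos hδ0, abs_of_pos (by norm_num)]
      linarith
  have hdisj : D ⊆ (K ∪ (fun u : ℝ => a + u * v) '' Icc s t)ᶜ := by
    rintro _ ⟨z, ⟨hz1, hz2⟩, rfl⟩ (hk | ⟨w, hw, hk⟩)
    · refine Metric.notMem_of_dist_lt_infDist (x := a + t * v) ?_ hk
      rw [dist_eq_norm]
      have : a + t * v - (a + (t + z) * v) = -(z * v) := by ring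
      rw [this, norm_neg, norm_mul]
      rw [mem_ball_zero_iff, hδ, lt_div_iff₀ hv'] at hz2
      exact hz2
    · have h1 := line_injective hv hk
      rw [mem_slitPlane_iff] at hz1
      have h2 := congrArg Complex.re h1
      have h3 := congrArg Complex.im h1
      simp at h2 h3
      rcases hz1 with hz1 | hz1
      · linarith [hw.2]
      · exact hz1 h3.symm
  have hc₁ := IsPreconnected.union _ (hmem 1 (by simp)).1 (hmem 1 (by simp)).2 hDc
    (sideTube_isPreconnected K a v isPreconnected_Ioc 1)
  have hc := IsPreconnected.union _ (mem_union_left _ (hmem (-1) (by simp)).1)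
    (hmem (-1) (by simp)).2 hc₁ (sideTube_isPreconnected K a v isPreconnected_Ioc (-1))
  refine numComp_le_of_isPreconnected (hK.union (isClosed_image_line a v s t)) hc
    ⟨_, Or.inl (Or.inl (hmem 1 (by simp)).1)⟩
    (union_subset (union_subset hdisj (sideTube_subset hK ⟨_, hs⟩ hv h (by simp) _))
      (sideTube_subset hK ⟨_, hs⟩ hv h (by simp) _)) ?_
  rintro _ ⟨u, hu, rfl⟩ hxK
  simp only at hxK
  have hu1 : s < u := lt_of_le_of_ne hu.1 (by rintro rfl; exact hxK hs)
  rcases hu.2.eq_or_lt with rfl | hu2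
  · have hz : Tendsto (fun y : ℂ => (y - a) / v - u) (𝓝 (a + u * v)) (𝓝 0) := by
      have : Continuous fun y : ℂ => (y - a) / v - u := by fun_prop
      convert this.tendsto (a + u * v) using 2
      field_simp; ring
    have h1 : ∀ᶠ z : ℂ in 𝓝 0, s - u < z.re :=
      Complex.continuous_re.continuousAt.eventually (lt_mem_nhds (by simpa using hu1))
    filter_upwards [hz.eventually h1, hz.eventually (Metric.ball_mem_nhds 0 hδ0)] with y hy1 hy2
    obtain ⟨z, rfl⟩ : ∃ z : ℂ, y = a + (u + z) * v := ⟨(y - a) / v - u, by field_simp; ring⟩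
    have hzz : (a + (u + z) * v - a) / v - u = z := by field_simp; ring
    rw [hzz] at hy1 hy2
    by_cases hslit : z ∈ slitPlane
    · exact Or.inr (Or.inl (Or.inl ⟨z, ⟨hslit, hy2⟩, rfl⟩))
    · rw [mem_slitPlane_iff] at hslit
      push Not at hslit
      refine Or.inl ⟨u + z.re, ⟨by linarith, by linarith [hslit.1]⟩, ?_⟩
      simp only
      congr 2
      apply Complex.ext <;> simp [hslit.2]
  · filter_upwards [eventually_mem_sideTube hK ⟨_, hs⟩ hv Ioc_subset_Icc_self
      (Ioc_mem_nhds hu1 hu2) hxK] with y hy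
    rcases hy with hy | hy | hy
    · exact Or.inl hy
    · exact Or.inr (Or.inl (Or.inr hy))
    · exact Or.inr (Or.inr hy)

/-- A punctured disc is connected, as the image of (0, r) × ℝ under polar coordinates. -/
theorem numComp_insert_point {K : Set ℂ} (hK : IsClosed K) (a : ℂ) :
    numComp (K ∪ {a}) ≤ numComp K := by
  by_cases ha : a ∈ K
  · rw [union_eq_self_of_subset_right (singleton_subset_iff.2 ha)]
  obtain ⟨r, hr, hball⟩ := Metric.isOpen_iff.1 hK.isOpen_compl a ha
  set N : Set ℂ := (fun q : ℝ × ℝ => a + q.1 * Complex.exp (q.2 * I)) '' (Ioo 0 r ×ˢ univ)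
  have hN : IsPreconnected N :=
    (isPreconnected_Ioo.prod isPreconnected_univ).image _ (Continuous.continuousOn (by fun_prop))
  refine numComp_le_of_isPreconnected (hK.union isClosed_singleton) hN
    (((nonempty_Ioo.2 hr).prod univ_nonempty).image _) ?_ ?_
  · rintro _ ⟨⟨ρ, θ⟩, ⟨hρ, -⟩, rfl⟩
    simp only at hρ ⊢
    have hnorm : ‖(ρ : ℂ) * Complex.exp (θ * I)‖ = ρ := by
      rw [norm_mul, norm_exp_ofReal_mul_I, norm_real, Real.norm_eq_abs, abs_of_pos hρ.1, mul_one]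
    rintro (h | h)
    · refine hball ?_ h
      rw [Metric.mem_ball, dist_eq_norm, add_sub_cancel_left, hnorm]
      exact hρ.2
    · rw [mem_singleton_iff, add_eq_left] at h
      rw [h, norm_zero] at hnorm
      exact hρ.1.ne hnorm
  · rintro x rfl -
    filter_upwards [Metric.ball_mem_nhds x hr] with y hy
    by_cases hyx : y = x
    · exact Or.inl hyx
    · refine Or.inr ⟨(‖y - x‖, arg (y - x)), ⟨⟨norm_pos_iff.2 (sub_ne_zero.2 hyx), ?_⟩,
        mem_univ _⟩, ?_⟩
      · rwa [Metric.mem_ball, dist_eq_norm] at hy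
      · simp

/-! ### Adding a segment which meets the old figure in few pieces -/

theorem numComp_free_edge_left {K : Set ℂ} (hK : IsClosed K) {a v : ℂ} (hv : v ≠ 0) {s t : ℝ}
    (hst : s < t) (ht : a + t * v ∈ K) (h : ∀ u ∈ Ico s t, a + u * v ∉ K) :
    numComp (K ∪ (fun u : ℝ => a + u * v) '' Icc s t) ≤ numComp K := by
  have h1 := numComp_free_edge hK (a := a) (v := -v) (neg_ne_zero.2 hv) (s := -t) (t := -s)
    (neg_lt_neg hst) (by simpa using ht) (fun u hu => by
      have := h (-u) ⟨by linarith [hu.2], by linarith [hu.1]⟩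
      simpa using this)
  convert h1 using 3
  ext y
  constructor
  · rintro ⟨u, hu, rfl⟩
    exact ⟨-u, ⟨by linarith [hu.2], by linarith [hu.1]⟩, by simp⟩
  · rintro ⟨u, hu, rfl⟩
    exact ⟨-u, ⟨by linarith [hu.2], by linarith [hu.1]⟩, by simp⟩

theorem image_line_split (a v : ℂ) {r s t : ℝ} (hrs : r ≤ s) (hst : s ≤ t) :
    (fun u : ℝ => a + u * v) '' Icc r t =
      (fun u : ℝ => a + u * v) '' Icc r s ∪ (fun u : ℝ => a + u * v) '' Icc s t := by
  rw [← image_union, Icc_union_Icc_eq_Icc hrs hst]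

/-- Walk along the line from t₀, alternately through a piece of `K` and across a gap. Every gap
crossed uses up one piece and creates at most one region; the last stretch is pendant and creates
none. -/
theorem numComp_sweep {a v : ℂ} (hv : v ≠ 0) (m : ℕ) :
    ∀ (K : Set ℂ) (F : Finset (Set ℝ)) (t₀ : ℝ), IsClosed K → t₀ ≤ 1 → a + t₀ * v ∈ K →
      F.card ≤ m + 1 → (∀ A ∈ F, A.OrdConnected ∧ IsClosed A) →
      (∀ t ∈ Icc t₀ 1, a + t * v ∈ K ↔ ∃ A ∈ F, t ∈ A) →
      numComp (K ∪ (fun u : ℝ => a + u * v) '' Icc t₀ 1) ≤ numComp K + m := by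
  classical
  induction m with
  | zero => ?_
  | succ m ih => ?_
  all_goals
    intro K F t₀ hK ht₀ ht₀K hF hFA hFK
    obtain ⟨A, hAF, hA⟩ := (hFK t₀ ⟨le_rfl, ht₀⟩).1 ht₀K
    -- c is the last parameter of the current piece A; up to c the line stays in K.
    obtain ⟨c, hc, hcmax⟩ : ∃ c ∈ A ∩ Icc t₀ 1, ∀ t ∈ A ∩ Icc t₀ 1, t ≤ c := by
      have hcomp : IsCompact (A ∩ Icc t₀ 1) := isCompact_Icc.inter_left (hFA A hAF).2
      obtain ⟨c, hc, hmax⟩ := hcomp.exists_isMaxOn ⟨t₀, hA, le_rfl, ht₀⟩ continuous_id.continuousOn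
      exact ⟨c, hc, fun t ht => hmax ht⟩
    have hsub : (fun u : ℝ => a + u * v) '' Icc t₀ c ⊆ K := by
      rintro _ ⟨u, hu, rfl⟩
      exact (hFK u ⟨hu.1, hu.2.trans hc.2.2⟩).2 ⟨A, hAF, (hFA A hAF).1.out hA hc.1 hu⟩
    have hcK : a + c * v ∈ K := hsub ⟨c, ⟨hc.2.1, le_rfl⟩, rfl⟩
    rw [image_line_split a v hc.2.1 hc.2.2, ← union_assoc, union_eq_self_of_subset_right hsub]
    have hcard : (F.erase A).card < F.card := Finset.card_erase_lt_of_mem hAF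
    set T : Set ℝ := {t | t ∈ Icc c 1 ∧ ∃ B ∈ F.erase A, t ∈ B} with hT
    have hend : T = ∅ → numComp (K ∪ (fun u : ℝ => a + u * v) '' Icc c 1) ≤ numComp K := by
      intro hT0
      rcases hc.2.2.eq_or_lt with hc1 | hc1
      · rw [hc1, Icc_self, image_singleton, union_eq_self_of_subset_right]
        rwa [singleton_subset_iff, ← hc1]
      · refine numComp_free_edge hK hv hc1 hcK fun u hu huK => ?_
        obtain ⟨B, hB, huB⟩ := (hFK u ⟨hc.2.1.trans hu.1.le, hu.2⟩).1 huK
        by_cases hBA : B = A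
        · subst hBA
          exact absurd (hcmax u ⟨huB, hc.2.1.trans hu.1.le, hu.2⟩) (not_le.2 hu.1)
        · have : u ∈ T := ⟨⟨hu.1.le, hu.2⟩, B, Finset.mem_erase.2 ⟨hBA, hB⟩, huB⟩
          rw [hT0] at this
          exact this
  · have h0 : F.erase A = ∅ := Finset.card_eq_zero.1 (by omega)
    have hT0 : T = ∅ := by
      rw [hT, h0]; simp
    simpa using hend hT0
  · rcases T.eq_empty_or_nonempty with hT0 | hTne
    · exact (hend hT0).trans le_self_add
    · have hTcomp : IsCompact T := by
        have : T = Icc c 1 ∩ ⋃ B ∈ F.erase A, B := by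
          ext t; simp [hT]
        rw [this]
        refine isCompact_Icc.inter_right ?_
        exact isClosed_biUnion_finset fun B hB => (hFA B (Finset.mem_of_mem_erase hB)).2
      -- d is the first parameter from c on that lies in another piece, so the gap between c and d
      -- is free of K.
      obtain ⟨d, hd, hdmin⟩ : ∃ d ∈ T, ∀ t ∈ T, d ≤ t := by
        obtain ⟨d, hd, hmin⟩ := hTcomp.exists_isMinOn hTne continuous_id.continuousOn
        exact ⟨d, hd, fun t ht => hmin ht⟩
      have hdK : a + d * v ∈ K := by
        obtain ⟨hd1, B, hB, hdB⟩ := hd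
        exact (hFK d ⟨hc.2.1.trans hd1.1, hd1.2⟩).2 ⟨B, Finset.mem_of_mem_erase hB, hdB⟩
      have hfree : ∀ u ∈ Ioo c d, a + u * v ∉ K := by
        intro u hu huK
        have hu1 : u ≤ 1 := hu.2.le.trans hd.1.2
        obtain ⟨B, hB, huB⟩ := (hFK u ⟨hc.2.1.trans hu.1.le, hu1⟩).1 huK
        by_cases hBA : B = A
        · subst hBA
          exact absurd (hcmax u ⟨huB, hc.2.1.trans hu.1.le, hu1⟩) (not_le.2 hu.1)
        · exact absurd (hdmin u ⟨⟨hu.1.le, hu1⟩, B, Finset.mem_erase.2 ⟨hBA, hB⟩, huB⟩)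
            (not_le.2 hu.2)
      have hfirst : numComp (K ∪ (fun u : ℝ => a + u * v) '' Icc c d) ≤ numComp K + 1 := by
        rcases hd.1.1.eq_or_lt with hcd | hcd
        · rw [← hcd, Icc_self, image_singleton, union_eq_self_of_subset_right]
          · exact le_self_add
          · rwa [singleton_subset_iff]
        · exact numComp_closing_edge hK hv hcd hcK hdK hfree
      rw [image_line_split a v hd.1.1 hd.1.2, ← union_assoc]
      -- The sweep restarts at d without A. Beyond d nothing of A is left, and the filled gap
      -- reaches no parameter beyond d, so the remaining pieces still describe the intersection.
      refine (ih (K ∪ (fun u : ℝ => a + u * v) '' Icc c d) (F.erase A) d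
        (hK.union (isClosed_image_line a v c d)) hd.1.2 (Or.inl hdK) (by omega)
        (fun B hB => hFA B (Finset.mem_of_mem_erase hB)) ?_).trans ?_
      · intro t ht
        have htI : t ∈ Icc t₀ 1 := ⟨(hc.2.1.trans hd.1.1).trans ht.1, ht.2⟩
        constructor
        · intro htK
          by_cases htd : t = d
          · rw [htd]; exact hd.2
          have hlt : d < t := lt_of_le_of_ne ht.1 (Ne.symm htd)
          rcases htK with htK | ⟨w, hw, hwt⟩
          · obtain ⟨B, hB, htB⟩ := (hFK t htI).1 htK
            by_cases hBA : B = A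
            · subst hBA
              exact absurd (hcmax t ⟨htB, htI⟩) (not_le.2 (hd.1.1.trans_lt hlt))
            · exact ⟨B, Finset.mem_erase.2 ⟨hBA, hB⟩, htB⟩
          · have : w = t := by exact_mod_cast line_injective hv hwt
            exact absurd hw.2 (not_le.2 (this ▸ hlt))
        · rintro ⟨B, hB, htB⟩
          exact Or.inl ((hFK t htI).2 ⟨B, Finset.mem_of_mem_erase hB, htB⟩)
      · push_cast
        rw [add_comm (m : ℕ∞) 1, ← add_assoc]
        gcongr

/-- `s` meets `K` in a union of at most `m` closed convex sets. -/
def Pieces (m : ℕ) (s K : Set ℂ) : Prop :=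
  ∃ F : Finset (Set ℂ), F.card ≤ m ∧ (∀ A ∈ F, Convex ℝ A ∧ IsClosed A) ∧ s ∩ K = ⋃₀ ↑F

theorem Pieces.mono {m m' : ℕ} {s K : Set ℂ} (h : Pieces m s K) (hm : m ≤ m') : Pieces m' s K := by
  obtain ⟨F, h1, h2⟩ := h
  exact ⟨F, h1.trans hm, h2⟩

theorem Pieces.union {m m' : ℕ} {s K K' : Set ℂ} (h : Pieces m s K) (h' : Pieces m' s K') :
    Pieces (m + m') s (K ∪ K') := by
  classical
  obtain ⟨F, h1, h2, h3⟩ := h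
  obtain ⟨F', h1', h2', h3'⟩ := h'
  refine ⟨F ∪ F', (Finset.card_union_le F F').trans (add_le_add h1 h1'), ?_, ?_⟩
  · intro A hA
    rcases Finset.mem_union.1 hA with hA | hA
    · exact h2 A hA
    · exact h2' A hA
  · rw [inter_union_distrib_left, h3, h3', Finset.coe_union, sUnion_union]

theorem Pieces.empty (s : Set ℂ) : Pieces 0 s ∅ :=
  ⟨∅, by simp⟩

theorem isClosed_segment (a b : ℂ) : IsClosed (segment ℝ a b) := by
  rw [segment_eq_image']
  exact (isCompact_Icc.image (by fun_prop)).isClosed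

theorem Pieces.segment (a b c d : ℂ) : Pieces 1 (segment ℝ a b) (segment ℝ c d) :=
  ⟨{_root_.segment ℝ a b ∩ _root_.segment ℝ c d}, by simp, by
    simpa using ⟨(convex_segment a b).inter (convex_segment c d),
      (isClosed_segment a b).inter (isClosed_segment c d)⟩, by simp⟩

theorem segment_eq_image_line (a b : ℂ) :
    segment ℝ a b = (fun u : ℝ => a + u * (b - a)) '' Icc 0 1 := by
  rw [segment_eq_image']
  rfl

theorem ordConnected_preimage_line {A : Set ℂ} (hA : Convex ℝ A) (a v : ℂ) :
    ((fun u : ℝ => a + u * v) ⁻¹' A).OrdConnected := by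
  have h : (fun u : ℝ => a + u * v) = AffineMap.lineMap (k := ℝ) a (a + v) := by
    ext1 u
    simp [AffineMap.lineMap_apply, add_comm]
  rw [h]
  exact (hA.affine_preimage _).ordConnected

theorem numComp_union_segment {K : Set ℂ} (hK : IsClosed K) {a b : ℂ} (hab : a ≠ b) {m : ℕ}
    (h : Pieces (m + 1) (segment ℝ a b) K) :
    numComp (K ∪ segment ℝ a b) ≤ numComp K + m := by
  classical
  obtain ⟨F, hF, hFA, hFK⟩ := h
  have hv : b - a ≠ 0 := sub_ne_zero.2 hab.symm
  rw [segment_eq_image_line] at hFK ⊢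
  set v := b - a with hvdef
  have hx : Continuous fun u : ℝ => a + u * v := by fun_prop
  set T : Set ℝ := {t | t ∈ Icc (0 : ℝ) 1 ∧ a + t * v ∈ K} with hT
  rcases T.eq_empty_or_nonempty with hT0 | hTne
  -- If the segment misses K, its end a is first inserted as an isolated point; the edge then hangs
  -- from it.
  · refine le_trans ?_ le_self_add
    refine le_trans ?_ (numComp_insert_point hK a)
    have h1 := numComp_free_edge (hK.union (isClosed_singleton (x := a))) hv (a := a) (s := 0)
      (t := 1) one_pos (by simp) (by
        rintro u hu (huK | hua)
        · have : u ∈ T := ⟨⟨hu.1.le, hu.2⟩, huK⟩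
          rw [hT0] at this
          exact this
        · rw [mem_singleton_iff, add_eq_left, mul_eq_zero] at hua
          rcases hua with hua | hua
          · exact hu.1.ne' (by exact_mod_cast hua)
          · exact hv hua)
    rwa [union_assoc, union_eq_self_of_subset_left (s := {a})] at h1
    rw [singleton_subset_iff]
    exact ⟨0, by simp, by simp⟩
  · have hTcomp : IsCompact T := isCompact_Icc.inter_right (hK.preimage hx)
    obtain ⟨d, hd, hdmin⟩ : ∃ d ∈ T, ∀ t ∈ T, d ≤ t := by
      obtain ⟨d, hd, hmin⟩ := hTcomp.exists_isMinOn hTne continuous_id.continuousOn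
      exact ⟨d, hd, fun t ht => hmin ht⟩
    -- The stretch before the first contact d is pendant and costs nothing.
    have hfirst : numComp (K ∪ (fun u : ℝ => a + u * v) '' Icc 0 d) ≤ numComp K := by
      rcases hd.1.1.eq_or_lt with hd0 | hd0
      · rw [← hd0, Icc_self, image_singleton, union_eq_self_of_subset_right]
        rw [singleton_subset_iff, hd0]
        exact hd.2
      · refine numComp_free_edge_left hK hv hd0 hd.2 fun u hu huK => ?_
        exact absurd (hdmin u ⟨⟨hu.1, hu.2.le.trans hd.1.2⟩, huK⟩) (not_le.2 hu.2)
    rw [image_line_split a v hd.1.1 hd.1.2, ← union_assoc]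
    refine (numComp_sweep hv m (K ∪ (fun u : ℝ => a + u * v) '' Icc 0 d)
      (F.image fun A => (fun u : ℝ => a + u * v) ⁻¹' A) d
      (hK.union (isClosed_image_line a v 0 d)) hd.1.2 (Or.inl hd.2)
      (Finset.card_image_le.trans hF) ?_ ?_).trans (add_le_add_left hfirst _)
    · intro A hA
      obtain ⟨B, hB, rfl⟩ := Finset.mem_image.1 hA
      exact ⟨ordConnected_preimage_line (hFA B hB).1 a v, (hFA B hB).2.preimage hx⟩
    · intro t ht
      have ht01 : t ∈ Icc (0 : ℝ) 1 := ⟨hd.1.1.trans ht.1, ht.2⟩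
      have hiff : a + t * v ∈ K ↔ a + t * v ∈ ⋃₀ (F : Set (Set ℂ)) := by
        rw [← hFK]
        exact ⟨fun h' => ⟨⟨t, ht01, rfl⟩, h'⟩, fun h' => h'.2⟩
      have hK1 : a + t * v ∈ K ∪ (fun u : ℝ => a + u * v) '' Icc 0 d ↔ a + t * v ∈ K := by
        refine ⟨?_, Or.inl⟩
        rintro (h' | ⟨w, hw, hwt⟩)
        · exact h'
        · have hwt' : w = t := by exact_mod_cast line_injective hv hwt
          have : t = d := le_antisymm (hwt' ▸ hw.2) ht.1
          rw [this]
          exact hd.2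
      rw [hK1, hiff]
      simp

/-! ### A segment meets an odd star with `m` vertices in at most `m - 1` pieces -/

/-- On a line, convex means connected, and two overlapping intervals have a connected union. -/
theorem convex_union_of_subset_segment {a b : ℂ} {A B : Set ℂ} (hA : Convex ℝ A)
    (hB : Convex ℝ B) (hAs : A ⊆ segment ℝ a b) (hBs : B ⊆ segment ℝ a b)
    (hAB : (A ∩ B).Nonempty) : Convex ℝ (A ∪ B) := by
  have himg : ∀ C ⊆ segment ℝ a b,
      AffineMap.lineMap (k := ℝ) a b '' (AffineMap.lineMap (k := ℝ) a b ⁻¹' C) = C := by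
    intro C hC
    refine image_preimage_eq_of_subset (hC.trans ?_)
    rw [segment_eq_image_lineMap]
    exact image_subset_range _ _
  obtain ⟨z, hzA, hzB⟩ := hAB
  obtain ⟨t, -, rfl⟩ := (segment_eq_image_lineMap ℝ a b) ▸ hAs hzA
  have hpre : IsPreconnected (AffineMap.lineMap (k := ℝ) a b ⁻¹' (A ∪ B)) := by
    rw [preimage_union]
    exact IsPreconnected.union t hzA hzB (hA.affine_preimage _).isPreconnected
      (hB.affine_preimage _).isPreconnected
  have hconv : Convex ℝ (AffineMap.lineMap (k := ℝ) a b ⁻¹' (A ∪ B)) :=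
    hpre.ordConnected.convex
  rw [← himg (A ∪ B) (union_subset hAs hBs)]
  exact hconv.affine_image _

/-- The m + 1 traces on the segment are already closed and convex. One is saved if a trace is empty,
or if two of them overlap and fuse into one convex set. -/
theorem Pieces.iUnion_of_card {m : ℕ} {ι : Type*} [Fintype ι] (hcard : Fintype.card ι = m + 1)
    {a b : ℂ} {d : ι → Set ℂ} (hconv : ∀ i, Convex ℝ (d i)) (hclosed : ∀ i, IsClosed (d i))
    (h : (∃ i, _root_.segment ℝ a b ∩ d i = ∅) ∨
      ∃ i j, i ≠ j ∧ (_root_.segment ℝ a b ∩ d i ∩ (_root_.segment ℝ a b ∩ d j)).Nonempty) :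
    Pieces m (_root_.segment ℝ a b) (⋃ i, d i) := by
  classical
  have hE : ∀ i, Convex ℝ (_root_.segment ℝ a b ∩ d i) ∧ IsClosed (_root_.segment ℝ a b ∩ d i) :=
    fun i => ⟨(convex_segment a b).inter (hconv i), (isClosed_segment a b).inter (hclosed i)⟩
  rcases h with ⟨i, hi⟩ | ⟨i, j, hij, hne⟩
  · refine ⟨(Finset.univ.erase i).image fun k => _root_.segment ℝ a b ∩ d k, ?_, ?_, ?_⟩
    · refine Finset.card_image_le.trans ?_
      rw [Finset.card_erase_of_mem (Finset.mem_univ i), Finset.card_univ, hcard]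
      simp
    · intro A hA
      obtain ⟨k, -, rfl⟩ := Finset.mem_image.1 hA
      exact hE k
    · ext z
      simp only [inter_iUnion, mem_iUnion, mem_sUnion, Finset.mem_coe, Finset.mem_image,
        Finset.mem_erase, Finset.mem_univ, and_true]
      constructor
      · rintro ⟨k, hk⟩
        refine ⟨_, ⟨k, ?_, rfl⟩, hk⟩
        rintro rfl
        rw [hi] at hk
        exact hk
      · rintro ⟨_, ⟨k, -, rfl⟩, hk⟩
        exact ⟨k, hk⟩
  · refine ⟨insert ((_root_.segment ℝ a b ∩ d i) ∪ (_root_.segment ℝ a b ∩ d j))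
      (((Finset.univ.erase i).erase j).image fun k => _root_.segment ℝ a b ∩ d k), ?_, ?_, ?_⟩
    · refine (Finset.card_insert_le _ _).trans ?_
      have h1 : ((Finset.univ.erase i).erase j).card = m - 1 := by
        rw [Finset.card_erase_of_mem (Finset.mem_erase.2 ⟨hij.symm, Finset.mem_univ j⟩),
          Finset.card_erase_of_mem (Finset.mem_univ i), Finset.card_univ, hcard]
        simp
      have h2 : 2 ≤ Fintype.card ι := by
        rw [← Finset.card_univ, ← Finset.card_pair hij]
        exact Finset.card_le_card (Finset.subset_univ _)
      have h3 := Finset.card_image_le (s := (Finset.univ.erase i).erase j)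
        (f := fun k => _root_.segment ℝ a b ∩ d k)
      omega
    · intro A hA
      rcases Finset.mem_insert.1 hA with rfl | hA
      · exact ⟨convex_union_of_subset_segment (hE i).1 (hE j).1 inter_subset_left
          inter_subset_left hne, (hE i).2.union (hE j).2⟩
      · obtain ⟨k, -, rfl⟩ := Finset.mem_image.1 hA
        exact hE k
    · ext z
      simp only [inter_iUnion, mem_iUnion, mem_sUnion, Finset.mem_coe, Finset.mem_insert,
        Finset.mem_image, Finset.mem_erase, Finset.mem_univ, and_true]
      constructor
      · rintro ⟨k, hk⟩
        by_cases hki : k = i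
        · subst hki
          exact ⟨_, Or.inl rfl, Or.inl hk⟩
        by_cases hkj : k = j
        · subst hkj
          exact ⟨_, Or.inl rfl, Or.inr hk⟩
        exact ⟨_, Or.inr ⟨k, ⟨hkj, hki⟩, rfl⟩, hk⟩
      · rintro ⟨_, rfl | ⟨k, -, rfl⟩, hk⟩
        · rcases hk with hk | hk
          · exact ⟨i, hk⟩
          · exact ⟨j, hk⟩
        · exact ⟨k, hk⟩

theorem orient_combo (a b c d : ℂ) {α β : ℝ} (h : α + β = 1) :
    orient a b (α • c + β • d) = α * orient a b c + β * orient a b d := by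
  have : α = 1 - β := by linarith
  subst this
  simp only [orient, add_re, real_smul, mul_re, ofReal_re, ofReal_im, add_im, mul_im]
  ring

theorem orient_eq_zero_of_mem_segment {a b z : ℂ} (hz : z ∈ segment ℝ a b) :
    orient a b z = 0 := by
  obtain ⟨α, β, -, -, h, rfl⟩ := hz
  rw [orient_combo a b a b h]
  simp only [orient]
  ring

theorem orient_eq_zero_of_line {a b : ℂ} (hab : a ≠ b) {x y z : ℂ} (hx : orient a b x = 0)
    (hy : orient a b y = 0) (hz : orient a b z = 0) : orient x y z = 0 := by
  have hne : b.re - a.re ≠ 0 ∨ b.im - a.im ≠ 0 := by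
    by_contra! h
    exact hab (Complex.ext (by linarith [h.1]) (by linarith [h.2]))
  simp only [orient] at hx hy hz ⊢
  rcases hne with h | h
  · refine (mul_eq_zero.1 ?_).resolve_left h
    linear_combination (y.re - x.re) * (hz - hx) - (z.re - x.re) * (hy - hx)
  · refine (mul_eq_zero.1 ?_).resolve_left h
    linear_combination (y.im - x.im) * (hz - hx) - (z.im - x.im) * (hy - hx)

/-- Otherwise all m sides meet the segment, in pairwise disjoint traces. The ends of every side then
lie weakly on opposite sides of the line ab, which an odd closed chain allows only if some vertex
lies on that line. Disjointness keeps this vertex off the segment, so its two sides must run along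
the line, making three vertices collinear against `hp`. -/
theorem Pieces.star_of_odd {m : ℕ} [NeZero m] (hodd : Odd m) (h2 : (2 : Fin m) ≠ 0)
    {p : Fin m → ℂ} (hp : ∀ i, orient (p i) (p (i + 2)) (p (i - 2)) ≠ 0) {a b : ℂ} (hab : a ≠ b) :
    Pieces (m - 1) (_root_.segment ℝ a b) (star p) := by
  refine Pieces.iUnion_of_card (by rw [Fintype.card_fin]; have := NeZero.pos m; omega)
    (fun i => convex_segment _ _) (fun i => isClosed_segment _ _) ?_
  by_contra! hcon
  obtain ⟨hne, hdisj⟩ := hcon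
  set f : ℂ → ℝ := orient a b with hf
  have hprod : ∀ i, 0 ≤ -(f (p i) * f (p (i + 2))) := by
    intro i
    obtain ⟨z, hz, α, β, hα, hβ, hαβ, rfl⟩ := hne i
    have h0 := orient_eq_zero_of_mem_segment hz
    rw [orient_combo _ _ _ _ hαβ] at h0
    change α * f (p i) + β * f (p (i + 2)) = 0 at h0
    by_contra! hlt
    have hpos : 0 < f (p i) * f (p (i + 2)) := by linarith
    rcases hα.eq_or_lt with rfl | hα
    · have : β = 1 := by linarith
      subst this
      have : f (p (i + 2)) = 0 := by linarith
      rw [this] at hpos; simp at hpos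
    · have h1 : α * (f (p i) * f (p (i + 2))) + β * f (p (i + 2)) ^ 2 = 0 := by
        linear_combination f (p (i + 2)) * h0
      have := mul_pos hα hpos
      nlinarith [mul_nonneg hβ (sq_nonneg (f (p (i + 2))))]
  -- Shifting the index by 2 permutes the vertices, so for odd m the product of the nonnegative
  -- numbers -f(pᵢ)f(pᵢ₊₂) is minus a square.
  have hzero : ∃ i, f (p i) = 0 := by
    have h1 : 0 ≤ ∏ i, -(f (p i) * f (p (i + 2))) := Finset.prod_nonneg fun i _ => hprod i
    have h3 : ∏ i, f (p (i + 2)) = ∏ i, f (p i) :=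
      Equiv.prod_comp (Equiv.addRight (2 : Fin m)) fun i => f (p i)
    rw [Finset.prod_neg, Finset.card_univ, Fintype.card_fin, hodd.neg_one_pow,
      Finset.prod_mul_distrib, h3] at h1
    have h4 : ∏ i, f (p i) = 0 := by nlinarith [sq_nonneg (∏ i, f (p i))]
    obtain ⟨i, -, hi⟩ := Finset.prod_eq_zero_iff.1 h4
    exact ⟨i, hi⟩
  obtain ⟨i, hi⟩ := hzero
  have hii : i - 2 + 2 = i := sub_add_cancel i 2
  -- The sides number i and i - 2 share the vertex p i; on the segment it would lie in both traces.
  have hnot : p i ∉ _root_.segment ℝ a b := by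
    intro hmem
    have hd := hdisj i (i - 2) (fun h => h2 (sub_eq_self.1 h.symm))
    refine (Set.eq_empty_iff_forall_notMem.1 hd) (p i)
      ⟨⟨hmem, left_mem_segment ℝ _ _⟩, hmem, ?_⟩
    rw [hii]
    exact right_mem_segment ℝ _ _
  -- The side meets the line at a point other than p i, where f vanishes as well, so f vanishes at
  -- its other end.
  have hfwd : f (p (i + 2)) = 0 := by
    obtain ⟨z, hz, α, β, hα, hβ, hαβ, rfl⟩ := hne i
    have h0 := orient_eq_zero_of_mem_segment hz
    rw [orient_combo _ _ _ _ hαβ] at h0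
    change α * f (p i) + β * f (p (i + 2)) = 0 at h0
    rw [hi, mul_zero, zero_add, mul_eq_zero] at h0
    refine h0.resolve_left ?_
    rintro rfl
    have : α = 1 := by linarith
    subst this
    simp only [one_smul, zero_smul, add_zero] at hz
    exact hnot hz
  have hbwd : f (p (i - 2)) = 0 := by
    obtain ⟨z, hz, α, β, hα, hβ, hαβ, rfl⟩ := hne (i - 2)
    have h0 := orient_eq_zero_of_mem_segment hz
    rw [orient_combo _ _ _ _ hαβ] at h0
    change α * f (p (i - 2)) + β * f (p (i - 2 + 2)) = 0 at h0
    rw [hii] at h0 hz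
    rw [hi, mul_zero, add_zero, mul_eq_zero] at h0
    refine h0.resolve_left ?_
    rintro rfl
    have : β = 1 := by linarith
    subst this
    simp only [one_smul, zero_smul, zero_add] at hz
    exact hnot hz
  exact hp i (orient_eq_zero_of_line hab hi hfwd hbwd)

/-! ### Upper bounds -/

theorem orient_rotate (a b c : ℂ) : orient a b c = orient b c a := by
  simp only [orient]; ring

theorem ne_of_orient_pos {a b c : ℂ} (h : 0 < orient a b c) : a ≠ b ∧ b ≠ c ∧ a ≠ c := by
  refine ⟨?_, ?_, ?_⟩ <;> rintro rfl <;> simp only [orient] at h <;> ring_nf at h <;>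
    exact lt_irrefl _ h

theorem IsConvexPolygon.pentagon_orient_ne {p : Fin 5 → ℂ} (hp : IsConvexPolygon p) (i : Fin 5) :
    orient (p i) (p (i + 2)) (p (i - 2)) ≠ 0 := by
  apply ne_of_gt
  fin_cases i
  · exact hp 0 2 3 (by decide) (by decide)
  · exact hp 1 3 4 (by decide) (by decide)
  · rw [← orient_rotate]; exact hp 0 2 4 (by decide) (by decide)
  · rw [orient_rotate]; exact hp 0 1 3 (by decide) (by decide)
  · rw [orient_rotate]; exact hp 1 2 4 (by decide) (by decide)

theorem Pieces.pentagram {p : Fin 5 → ℂ} (hp : IsConvexPolygon p) {a b : ℂ} (hab : a ≠ b) :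
    Pieces 4 (_root_.segment ℝ a b) (star p) :=
  Pieces.star_of_odd (m := 5) (by decide) (by decide) hp.pentagon_orient_ne hab

theorem Pieces.triangle {q : Fin 3 → ℂ} (hq : 0 < orient (q 0) (q 1) (q 2)) {a b : ℂ}
    (hab : a ≠ b) : Pieces 2 (_root_.segment ℝ a b) (star q) := by
  refine Pieces.star_of_odd (m := 3) (by decide) (by decide) (fun i => ?_) hab
  have hneg : ∀ x y z : ℂ, orient x y z = -orient x z y := by
    intro x y z; simp only [orient]; ring
  rw [hneg, neg_ne_zero]
  apply ne_of_gt
  fin_cases i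
  · exact hq
  · rw [← orient_rotate]; exact hq
  · rw [orient_rotate]; exact hq

theorem star_eq_union_five (p : Fin 5 → ℂ) : star p = segment ℝ (p 0) (p 2) ∪
    segment ℝ (p 1) (p 3) ∪ segment ℝ (p 2) (p 4) ∪ segment ℝ (p 3) (p 0) ∪
    segment ℝ (p 4) (p 1) := by
  ext z
  simp only [star, mem_iUnion, mem_union, Fin.exists_fin_succ]
  simp [or_assoc]

theorem star_eq_union_three (q : Fin 3 → ℂ) : star q = segment ℝ (q 0) (q 2) ∪
    segment ℝ (q 1) (q 0) ∪ segment ℝ (q 2) (q 1) := by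
  ext z
  simp only [star, mem_iUnion, mem_union, Fin.exists_fin_succ]
  simp [or_assoc]

theorem star_eq_union_triangles (p : Fin 6 → ℂ) :
    star p = star ![p 0, p 2, p 4] ∪ star ![p 1, p 3, p 5] := by
  rw [star_eq_union_three, star_eq_union_three]
  ext z
  simp only [star, mem_iUnion, mem_union, Fin.exists_fin_succ]
  simp only [Matrix.cons_val]
  rw [segment_symm ℝ (p 0) (p 4), segment_symm ℝ (p 2) (p 0), segment_symm ℝ (p 4) (p 2),
    segment_symm ℝ (p 1) (p 5), segment_symm ℝ (p 3) (p 1), segment_symm ℝ (p 5) (p 3)]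
  simp
  tauto

theorem isClosed_star {m : ℕ} [NeZero m] (p : Fin m → ℂ) : IsClosed (star p) :=
  isClosed_iUnion_of_finite fun _ => isClosed_segment _ _

/-- Every segment meets `K` in at most `m` pieces. -/
def MeetsInPieces (m : ℕ) (K : Set ℂ) : Prop :=
  ∀ a b : ℂ, a ≠ b → Pieces m (segment ℝ a b) K

/-- The truncation of m - 1 at m = 0 is intended: a segment disjoint from K costs nothing, but does
not lower the count. -/
theorem numComp_union_segment_le {K : Set ℂ} (hK : IsClosed K) {a b : ℂ} (hab : a ≠ b) {m : ℕ}
    (h : Pieces m (segment ℝ a b) K) :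
    numComp (K ∪ segment ℝ a b) ≤ numComp K + (m - 1 : ℕ) :=
  numComp_union_segment hK hab (h.mono (by omega))

theorem MeetsInPieces.union {m m' : ℕ} {K K' : Set ℂ} (h : MeetsInPieces m K)
    (h' : MeetsInPieces m' K') : MeetsInPieces (m + m') (K ∪ K') :=
  fun a b hab => (h a b hab).union (h' a b hab)

theorem MeetsInPieces.segment (c d : ℂ) : MeetsInPieces 1 (_root_.segment ℝ c d) :=
  fun a b _ => Pieces.segment a b c d

/-- The i-th segment (i = 0, ..., 4) meets K in at most m pieces and the i earlier segments in at
most one piece each, so it costs at most m + i - 1. -/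
theorem numComp_union_star_five {K : Set ℂ} (hK : IsClosed K) {m : ℕ} (h : MeetsInPieces m K)
    {p : Fin 5 → ℂ} (hp : IsConvexPolygon p) :
    numComp (K ∪ star p) ≤ numComp K + ((m - 1) + m + (m + 1) + (m + 2) + (m + 3) : ℕ) := by
  have h1 := h.union (MeetsInPieces.segment (p 0) (p 2))
  have h2 := h1.union (MeetsInPieces.segment (p 1) (p 3))
  have h3 := h2.union (MeetsInPieces.segment (p 2) (p 4))
  have h4 := h3.union (MeetsInPieces.segment (p 3) (p 0))
  have k1 := hK.union (isClosed_segment (p 0) (p 2))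
  have k2 := k1.union (isClosed_segment (p 1) (p 3))
  have k3 := k2.union (isClosed_segment (p 2) (p 4))
  have k4 := k3.union (isClosed_segment (p 3) (p 0))
  have e02 := (ne_of_orient_pos (hp 0 1 2 (by decide) (by decide))).2.2
  have e13 := (ne_of_orient_pos (hp 1 2 3 (by decide) (by decide))).2.2
  have e24 := (ne_of_orient_pos (hp 2 3 4 (by decide) (by decide))).2.2
  have e30 := (ne_of_orient_pos (hp 0 1 3 (by decide) (by decide))).2.2.symm
  have e41 := (ne_of_orient_pos (hp 1 2 4 (by decide) (by decide))).2.2.symm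
  rw [star_eq_union_five, ← union_assoc, ← union_assoc, ← union_assoc, ← union_assoc]
  calc _ ≤ _ := numComp_union_segment_le k4 e41 (h4 _ _ e41)
    _ ≤ _ := add_le_add_left (numComp_union_segment_le k3 e30 (h3 _ _ e30)) _
    _ ≤ _ := add_le_add_left (add_le_add_left (numComp_union_segment_le k2 e24 (h2 _ _ e24)) _) _
    _ ≤ _ := add_le_add_left (add_le_add_left (add_le_add_left
      (numComp_union_segment_le k1 e13 (h1 _ _ e13)) _) _) _
    _ ≤ _ := add_le_add_left (add_le_add_left (add_le_add_left (add_le_add_left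
      (numComp_union_segment_le hK e02 (h _ _ e02)) _) _) _) _
    _ = _ := by push_cast [Nat.add_sub_cancel, ← add_assoc]; norm_num [add_assoc]

theorem numComp_union_star_three {K : Set ℂ} (hK : IsClosed K) {m : ℕ} (h : MeetsInPieces m K)
    {q : Fin 3 → ℂ} (hq : 0 < orient (q 0) (q 1) (q 2)) :
    numComp (K ∪ star q) ≤ numComp K + ((m - 1) + m + (m + 1) : ℕ) := by
  have h1 := h.union (MeetsInPieces.segment (q 0) (q 2))
  have h2 := h1.union (MeetsInPieces.segment (q 1) (q 0))
  have k1 := hK.union (isClosed_segment (q 0) (q 2))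
  have k2 := k1.union (isClosed_segment (q 1) (q 0))
  obtain ⟨e01, e12, e02⟩ := ne_of_orient_pos hq
  rw [star_eq_union_three, ← union_assoc, ← union_assoc]
  calc _ ≤ _ := numComp_union_segment_le k2 e12.symm (h2 _ _ e12.symm)
    _ ≤ _ := add_le_add_left (numComp_union_segment_le k1 e01.symm (h1 _ _ e01.symm)) _
    _ ≤ _ := add_le_add_left (add_le_add_left
      (numComp_union_segment_le hK e02 (h _ _ e02)) _) _
    _ = _ := by push_cast [Nat.add_sub_cancel, ← add_assoc]; norm_num [add_assoc]

theorem MeetsInPieces.pentagram {p : Fin 5 → ℂ} (hp : IsConvexPolygon p) :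
    MeetsInPieces 4 (star p) :=
  fun _ _ hab => Pieces.pentagram hp hab

theorem MeetsInPieces.triangle {q : Fin 3 → ℂ} (hq : 0 < orient (q 0) (q 1) (q 2)) :
    MeetsInPieces 2 (star q) :=
  fun _ _ hab => Pieces.triangle hq hab

theorem iUnion_fin_succ_last {n : ℕ} (S : Fin (n + 1) → Set ℂ) :
    ⋃ i, S i = (⋃ i : Fin n, S i.castSucc) ∪ S (Fin.last n) := by
  ext z
  simp only [mem_iUnion, mem_union, Fin.exists_fin_succ']

theorem pentagrams_bound (n : ℕ) : ∀ S : Fin n → Set ℂ, (∀ i, IsPentagram (S i)) →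
    IsClosed (⋃ i, S i) ∧ MeetsInPieces (4 * n) (⋃ i, S i) ∧
      (n = 0 → numComp (⋃ i, S i) ≤ 1) ∧
      (1 ≤ n → numComp (⋃ i, S i) ≤ ((10 * n ^ 2 - 5 * n + 2 : ℕ) : ℕ∞)) := by
  induction n with
  | zero =>
    intro S _
    simp only [iUnion_of_empty]
    exact ⟨isClosed_empty, fun _ _ _ => Pieces.empty _, fun _ => numComp_empty_le, by simp⟩
  | succ n ih =>
    intro S hS
    obtain ⟨h1, h2, h3, h4⟩ := ih (fun i => S i.castSucc) fun i => hS _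
    obtain ⟨p, hp, hSp⟩ := hS (Fin.last n)
    rw [iUnion_fin_succ_last, hSp]
    refine ⟨h1.union (isClosed_star p), h2.union (MeetsInPieces.pentagram hp), by simp, fun _ => ?_⟩
    refine (numComp_union_star_five h1 h2 hp).trans ?_
    rcases Nat.eq_zero_or_pos n with rfl | hn
    -- For the first pentagram m = 0 and m - 1 truncates to 0: the bound is 1 + (0 + 0 + 1 + 2 + 3)
    -- = 7.
    · exact (add_le_add_left (h3 rfl) _).trans (by norm_num)
    · refine (add_le_add_left (h4 hn) _).trans ?_
      norm_cast
      zify [show 5 * n ≤ 10 * n ^ 2 by nlinarith, show 1 ≤ 4 * n by omega,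
        show 5 * (n + 1) ≤ 10 * (n + 1) ^ 2 by nlinarith]
      linarith

theorem hexagrams_bound (n : ℕ) : ∀ S : Fin n → Set ℂ, (∀ i, IsHexagram (S i)) →
    IsClosed (⋃ i, S i) ∧ MeetsInPieces (4 * n) (⋃ i, S i) ∧
      (n = 0 → numComp (⋃ i, S i) ≤ 1) ∧
      (1 ≤ n → numComp (⋃ i, S i) ≤ ((2 * (6 * n ^ 2 - 3 * n + 1) : ℕ) : ℕ∞)) := by
  induction n with
  | zero =>
    intro S _
    simp only [iUnion_of_empty]
    exact ⟨isClosed_empty, fun _ _ _ => Pieces.empty _, fun _ => numComp_empty_le, by simp⟩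
  | succ n ih =>
    intro S hS
    obtain ⟨h1, h2, h3, h4⟩ := ih (fun i => S i.castSucc) fun i => hS _
    obtain ⟨p, hp, hSp⟩ := hS (Fin.last n)
    have hq : 0 < orient (![p 0, p 2, p 4] 0) (![p 0, p 2, p 4] 1) (![p 0, p 2, p 4] 2) :=
      hp 0 2 4 (by decide) (by decide)
    have hr : 0 < orient (![p 1, p 3, p 5] 0) (![p 1, p 3, p 5] 1) (![p 1, p 3, p 5] 2) :=
      hp 1 3 5 (by decide) (by decide)
    rw [iUnion_fin_succ_last, hSp, star_eq_union_triangles, ← union_assoc]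
    have h5 := h2.union (MeetsInPieces.triangle hq)
    have h6 := h1.union (isClosed_star ![p 0, p 2, p 4])
    refine ⟨h6.union (isClosed_star _), h5.union (MeetsInPieces.triangle hr), by simp, fun _ => ?_⟩
    refine (numComp_union_star_three h6 h5 hr).trans ?_
    refine (add_le_add_left (numComp_union_star_three h1 h2 hq) _).trans ?_
    rcases Nat.eq_zero_or_pos n with rfl | hn
    -- For the first hexagram the triangles contribute 0 + 0 + 1 and 1 + 2 + 3, which gives 8.
    · exact (add_le_add_left (add_le_add_left (h3 rfl) _) _).trans (by norm_num)
    · refine (add_le_add_left (add_le_add_left (h4 hn) _) _).trans ?_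
      norm_cast
      zify [show 3 * n ≤ 6 * n ^ 2 by nlinarith, show 1 ≤ 4 * n by omega,
        show 1 ≤ 4 * n + 2 by omega, show 3 * (n + 1) ≤ 6 * (n + 1) ^ 2 by nlinarith]
      linarith

/-! ### Crossings of pentagrams -/

theorem Convex.subsingleton_of_finite {A : Set ℂ} (hA : Convex ℝ A) (hfin : A.Finite) :
    A.Subsingleton := by
  by_contra h
  rw [not_subsingleton_iff] at h
  obtain ⟨x, hx, y, hy, hxy⟩ := h
  have hinf : (segment ℝ x y).Infinite := by
    rw [segment_eq_image_lineMap]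
    exact (Icc_infinite one_pos).image (AffineMap.lineMap_injective ℝ hxy).injOn
  exact hinf (hfin.subset (hA.segment_subset hx hy))

/-- A finite convex set has at most one point, so finiteness turns pieces into points. -/
theorem Pieces.encard_le {m : ℕ} {s K : Set ℂ} (h : Pieces m s K) (hfin : (s ∩ K).Finite) :
    (s ∩ K).encard ≤ m := by
  classical
  obtain ⟨F, hF, hFA, hFK⟩ := h
  rw [hFK, sUnion_eq_biUnion]
  have hsub : ∀ A ∈ F, A.encard ≤ 1 := by
    intro A hA
    rw [encard_le_one_iff_subsingleton]
    refine Convex.subsingleton_of_finite (hFA A hA).1 (hfin.subset ?_)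
    rw [hFK]
    exact subset_sUnion_of_mem hA
  have key : ∀ G : Finset (Set ℂ), (∀ A ∈ G, A.encard ≤ 1) →
      (⋃ A ∈ (G : Set (Set ℂ)), A).encard ≤ G.card := by
    intro G
    induction G using Finset.induction_on with
    | empty => simp
    | insert A G hA ih =>
      intro hG
      rw [Finset.coe_insert, biUnion_insert, Finset.card_insert_of_notMem hA, add_comm]
      push_cast
      refine (encard_union_le _ _).trans (add_le_add (hG A (Finset.mem_insert_self A G)) ?_)
      exact ih fun B hB => hG B (Finset.mem_insert_of_mem hB)
  exact (key F hsub).trans (by exact_mod_cast hF)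

theorem pentagram_inter_encard_le {P Q : Set ℂ} (hP : IsPentagram P) (hQ : IsPentagram Q)
    (hfin : (P ∩ Q).Finite) : (P ∩ Q).encard ≤ 20 := by
  obtain ⟨p, hp, rfl⟩ := hP
  obtain ⟨q, hq, rfl⟩ := hQ
  have key : ∀ i j, p i ≠ p j → segment ℝ (p i) (p j) ⊆ star p →
      (segment ℝ (p i) (p j) ∩ star q).encard ≤ 4 := fun i j hij hsub =>
    (Pieces.pentagram hq hij).encard_le (hfin.subset (inter_subset_inter_left _ hsub))
  have e02 := (ne_of_orient_pos (hp 0 1 2 (by decide) (by decide))).2.2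
  have e13 := (ne_of_orient_pos (hp 1 2 3 (by decide) (by decide))).2.2
  have e24 := (ne_of_orient_pos (hp 2 3 4 (by decide) (by decide))).2.2
  have e30 := (ne_of_orient_pos (hp 0 1 3 (by decide) (by decide))).2.2.symm
  have e41 := (ne_of_orient_pos (hp 1 2 4 (by decide) (by decide))).2.2.symm
  have hsub : ∀ i, segment ℝ (p i) (p (i + 2)) ⊆ star p := fun i =>
    subset_iUnion (fun j => segment ℝ (p j) (p (j + 2))) i
  have k0 := key 0 2 e02 (hsub 0)
  have k1 := key 1 3 e13 (hsub 1)
  have k2 := key 2 4 e24 (hsub 2)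
  have k3 := key 3 0 e30 (hsub 3)
  have k4 := key 4 1 e41 (hsub 4)
  rw [star_eq_union_five p, union_inter_distrib_right, union_inter_distrib_right,
    union_inter_distrib_right, union_inter_distrib_right]
  refine (encard_union_le _ _).trans ((add_le_add ((encard_union_le _ _).trans (add_le_add
    ((encard_union_le _ _).trans (add_le_add ((encard_union_le _ _).trans
      (add_le_add k0 k1)) k2)) k3)) k4).trans ?_)
  norm_num

/-- The diagonal bd divides ac in the ratio of the areas of abd and bcd, and likewise ac divides bd.
Both sums of areas equal that of the quadrilateral, which normalises the weights. -/
theorem exists_crossing {a b c d : ℂ} (habc : 0 < orient a b c) (habd : 0 < orient a b d)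
    (hacd : 0 < orient a c d) (hbcd : 0 < orient b c d) :
    (openSegment ℝ a c ∩ openSegment ℝ b d).Nonempty := by
  have hsum : orient b c d + orient a b d = orient a c d + orient a b c := by
    simp only [orient]; ring
  have hpos : 0 < orient b c d + orient a b d := add_pos hbcd habd
  set s := orient b c d + orient a b d with hs
  refine ⟨(orient b c d / s) • a + (orient a b d / s) • c,
    ⟨_, _, div_pos hbcd hpos, div_pos habd hpos, by rw [← add_div, div_self hpos.ne'], rfl⟩,
    orient a c d / s, orient a b c / s, div_pos hacd hpos, div_pos habc hpos, ?_, ?_⟩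
  · rw [← add_div, ← hsum, div_self hpos.ne']
  · have hs0 : (s : ℂ) ≠ 0 := by exact_mod_cast hpos.ne'
    simp only [real_smul, ofReal_div]
    field_simp
    apply Complex.ext <;> simp [orient] <;> ring

theorem eq_of_mem_segments {a b c d x y : ℂ} (h : orient a b c ≠ orient a b d)
    (hx : x ∈ segment ℝ a b ∩ segment ℝ c d) (hy : y ∈ segment ℝ a b ∩ segment ℝ c d) : x = y := by
  have hx0 := orient_eq_zero_of_mem_segment hx.1
  have hy0 := orient_eq_zero_of_mem_segment hy.1
  obtain ⟨α, β, -, -, hαβ, rfl⟩ := hx.2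
  obtain ⟨γ, δ, -, -, hγδ, rfl⟩ := hy.2
  rw [orient_combo _ _ _ _ hαβ] at hx0
  rw [orient_combo _ _ _ _ hγδ] at hy0
  have hα : α = 1 - β := by linarith
  have hγ : γ = 1 - δ := by linarith
  subst hα hγ
  have : (β - δ) * (orient a b d - orient a b c) = 0 := by linarith
  rcases mul_eq_zero.1 this with h' | h'
  · have : β = δ := by linarith
    rw [this]
  · exact absurd (by linarith) h

theorem openSegment_disjoint_of_orient_ne {a b c : ℂ} (h : orient a b c ≠ 0) :
    Disjoint (openSegment ℝ a b) (openSegment ℝ b c) := by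
  rw [Set.disjoint_left]
  rintro x hx ⟨α, β, -, hβ, hαβ, rfl⟩
  have hx0 := orient_eq_zero_of_mem_segment (openSegment_subset_segment ℝ _ _ hx)
  rw [orient_combo _ _ _ _ hαβ, orient_eq_zero_of_mem_segment (right_mem_segment ℝ a b), mul_zero,
    zero_add, mul_eq_zero] at hx0
  exact hx0.elim hβ.ne' h

theorem IsConvexPolygon.pentagon_orient_pos {p : Fin 5 → ℂ} (hp : IsConvexPolygon p) (i : Fin 5) :
    0 < orient (p i) (p (i + 1)) (p (i + 2)) ∧ 0 < orient (p i) (p (i + 1)) (p (i + 3)) ∧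
      0 < orient (p i) (p (i + 2)) (p (i + 3)) ∧
      0 < orient (p (i + 1)) (p (i + 2)) (p (i + 3)) ∧
      0 < orient (p i) (p (i + 2)) (p (i + 4)) := by
  have h : ∀ i j k : Fin 5, (i < j ∧ j < k) ∨ (j < k ∧ k < i) ∨ (k < i ∧ i < j) →
      0 < orient (p i) (p j) (p k) := by
    rintro i j k (h | h | h)
    · exact hp i j k h.1 h.2
    · rw [orient_rotate]; exact hp j k i h.1 h.2
    · rw [← orient_rotate]; exact hp k i j h.1 h.2
  refine ⟨h _ _ _ ?_, h _ _ _ ?_, h _ _ _ ?_, h _ _ _ ?_, h _ _ _ ?_⟩ <;> revert i <;> decide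

/-- Diagonals i and i + 1 cross exactly once, while i and i + 2 share a vertex and have disjoint
interiors; up to order these are all pairs. Two of the five crossings cannot coincide, since the
point would be interior to two diagonals with a common vertex. -/
theorem selfCrossings_encard {p : Fin 5 → ℂ} (hp : IsConvexPolygon p) :
    (selfCrossings p).encard = 5 := by
  set d : Fin 5 → Set ℂ := fun i => openSegment ℝ (p i) (p (i + 2)) with hd
  have hcross : ∀ i, (d i ∩ d (i + 1)).Nonempty := by
    intro i
    obtain ⟨h1, h2, h3, h4, -⟩ := hp.pentagon_orient_pos i
    have := exists_crossing h1 h2 h3 h4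
    have h13 : i + 1 + 2 = i + 3 := by rw [add_assoc]; rfl
    simpa only [hd, h13] using this
  have huniq : ∀ i, ∀ x ∈ d i ∩ d (i + 1), ∀ y ∈ d i ∩ d (i + 1), x = y := by
    intro i x hx y hy
    obtain ⟨h1, h2, h3, h4, -⟩ := hp.pentagon_orient_pos i
    have hne : orient (p i) (p (i + 2)) (p (i + 1)) ≠ orient (p i) (p (i + 2)) (p (i + 1 + 2)) := by
      have : orient (p i) (p (i + 2)) (p (i + 1)) = -orient (p i) (p (i + 1)) (p (i + 2)) := by
        simp only [orient]; ring
      rw [this, add_assoc]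
      intro heq
      have h3' : 0 < orient (p i) (p (i + 2)) (p (i + (1 + 2))) := h3
      linarith
    exact eq_of_mem_segments hne
      ⟨openSegment_subset_segment ℝ _ _ hx.1, openSegment_subset_segment ℝ _ _ hx.2⟩
      ⟨openSegment_subset_segment ℝ _ _ hy.1, openSegment_subset_segment ℝ _ _ hy.2⟩
  have hdisj : ∀ i, Disjoint (d i) (d (i + 2)) := by
    intro i
    refine openSegment_disjoint_of_orient_ne ?_
    rw [add_assoc]
    exact (hp.pentagon_orient_pos i).2.2.2.2.ne'
  choose x hx using hcross
  have hxinj : Function.Injective x := by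
    intro i j hij
    by_contra hne
    have hcases : ∀ i j : Fin 5, i ≠ j → j = i + 1 ∨ i = j + 1 ∨ j = i + 2 ∨ i = j + 2 := by
      decide
    have hi := hx i
    have hj := hx j
    rw [← hij] at hj
    rcases hcases i j hne with h | h | h | h
    · refine Set.disjoint_left.1 (hdisj i) hi.1 ?_
      have := hj.2
      rwa [h, add_assoc] at this
    · refine Set.disjoint_left.1 (hdisj j) hj.1 ?_
      have := hi.2
      rw [h, add_assoc] at this
      rwa [h]
    · exact Set.disjoint_left.1 (hdisj i) hi.1 (h ▸ hj.1)
    · exact Set.disjoint_left.1 (hdisj j) hj.1 (h ▸ hi.1)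
  have hset : selfCrossings p = range x := by
    ext z
    constructor
    · rintro ⟨i, j, hij, hzi, hzj⟩
      have hcases : ∀ i j : Fin 5, i ≠ j → j = i + 1 ∨ i = j + 1 ∨ j = i + 2 ∨ i = j + 2 := by
        decide
      rcases hcases i j hij with h | h | h | h
      · subst h
        exact ⟨i, huniq i _ (hx i) _ ⟨hzi, hzj⟩⟩
      · subst h
        exact ⟨j, huniq j _ (hx j) _ ⟨hzj, hzi⟩⟩
      · subst h
        exact absurd hzj (Set.disjoint_left.1 (hdisj i) hzi)
      · subst h
        exact absurd hzi (Set.disjoint_left.1 (hdisj j) hzj)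
    · rintro ⟨i, rfl⟩
      exact ⟨i, i + 1, by revert i; decide, (hx i).1, (hx i).2⟩
  rw [hset, ← image_univ, hxinj.injOn.encard_image, encard_univ]
  simp

/-! ### Regular polygons are convex -/

/-- This is sin 2u + sin 2v - sin 2(u+v) = 4 sin u sin v sin(u+v), with u and v half the angular
steps. -/
theorem orient_circle (c ρ : ℂ) (α β γ : ℝ) :
    orient (c + ρ * Complex.exp (α * I)) (c + ρ * Complex.exp (β * I))
      (c + ρ * Complex.exp (γ * I)) =
    normSq ρ * (4 * Real.sin ((β - α) / 2) * Real.sin ((γ - β) / 2) * Real.sin ((γ - α) / 2)) := by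
  obtain ⟨u, hu⟩ : ∃ u, β = α + 2 * u := ⟨(β - α) / 2, by ring⟩
  obtain ⟨v, hv⟩ : ∃ v, γ = β + 2 * v := ⟨(γ - β) / 2, by ring⟩
  have h1 : (β - α) / 2 = u := by rw [hu]; ring
  have h2 : (γ - β) / 2 = v := by rw [hv]; ring
  have h3 : (γ - α) / 2 = u + v := by rw [hv, hu]; ring
  rw [h1, h2, h3, hv, hu, show α + 2 * u + 2 * v = α + 2 * (u + v) by ring]
  have h4 : orient (c + ρ * Complex.exp (α * I)) (c + ρ * Complex.exp ((α + 2 * u : ℝ) * I))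
      (c + ρ * Complex.exp ((α + 2 * (u + v) : ℝ) * I)) = normSq ρ *
        (Real.sin ((α + 2 * u) - α) + Real.sin ((α + 2 * (u + v)) - (α + 2 * u)) -
          Real.sin ((α + 2 * (u + v)) - α)) := by
    simp only [orient, normSq_apply, add_re, mul_re, add_im, mul_im, exp_ofReal_mul_I_re,
      exp_ofReal_mul_I_im, Real.sin_sub]
    ring
  rw [h4, show α + 2 * u - α = 2 * u by ring, show α + 2 * (u + v) - α = 2 * (u + v) by ring,
    show α + 2 * (u + v) - (α + 2 * u) = 2 * v by ring]
  congr 1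
  simp only [Real.sin_two_mul, Real.sin_add, Real.cos_add]
  linear_combination -2 * Real.sin u * Real.cos u * Real.sin_sq_add_cos_sq v -
    2 * Real.sin v * Real.cos v * Real.sin_sq_add_cos_sq u

theorem circlePoint_eq (c ρ : ℂ) (N j : ℕ) :
    circlePoint c ρ N j = c + ρ * Complex.exp ((2 * Real.pi * (j / N) : ℝ) * I) := by
  rw [circlePoint]
  congr 3
  push_cast
  ring

theorem IsRegularPolygon.isConvexPolygon {m : ℕ} {p : Fin m → ℂ} (hp : IsRegularPolygon p) :
    IsConvexPolygon p := by
  obtain ⟨c, ρ, hρ, hp⟩ := hp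
  intro i j k hij hjk
  rw [hp, hp, hp, circlePoint_eq, circlePoint_eq, circlePoint_eq, orient_circle]
  have hm : (0 : ℝ) < m := by exact_mod_cast i.pos
  have key : ∀ a b : Fin m, a < b →
      0 < Real.sin ((2 * Real.pi * (b / m) - 2 * Real.pi * (a / m)) / 2) := by
    intro a b hab
    have hab' : ((a : ℕ) : ℝ) < ((b : ℕ) : ℝ) := by exact_mod_cast hab
    have hb : ((b : ℕ) : ℝ) < m := by exact_mod_cast b.2
    have ha : (0 : ℝ) ≤ ((a : ℕ) : ℝ) := Nat.cast_nonneg _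
    have heq : (2 * Real.pi * ((b : ℕ) / m : ℝ) - 2 * Real.pi * ((a : ℕ) / m : ℝ)) / 2 =
        Real.pi * ((((b : ℕ) : ℝ) - (a : ℕ)) / m) := by ring
    rw [heq]
    have h1 : 0 < (((b : ℕ) : ℝ) - (a : ℕ)) / m := div_pos (by linarith) hm
    have h2 : (((b : ℕ) : ℝ) - (a : ℕ)) / m < 1 := by rw [div_lt_one hm]; linarith
    apply Real.sin_pos_of_pos_of_lt_pi
    · exact mul_pos Real.pi_pos h1
    · nlinarith [Real.pi_pos]
  have h1 := key i j hij
  have h2 := key j k hjk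
  have h3 := key i k (hij.trans hjk)
  have h4 : 0 < normSq ρ := normSq_pos.2 hρ
  positivity

theorem IsRegularPentagram.isPentagram {S : Set ℂ} (h : IsRegularPentagram S) : IsPentagram S := by
  obtain ⟨p, hp, rfl⟩ := h
  exact ⟨p, hp.isConvexPolygon, rfl⟩

theorem IsRegularHexagram.isHexagram {S : Set ℂ} (h : IsRegularHexagram S) : IsHexagram S := by
  obtain ⟨p, hp, rfl⟩ := h
  exact ⟨p, hp.isConvexPolygon, rfl⟩

/-! ### The stars on equally spaced points of a circle -/

/-- The direction, seen from the centre, of the chord that joins the `b`-th of `N` equally spaced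
points of the unit circle to the point number `b + 2 * n`. -/
noncomputable def chordAngle (N n : ℕ) (b : ℤ) : ℝ := 2 * Real.pi * (b + n) / N

/-- The signed distance of `w` from the line through the points number `b` and `b + 2 * n` of `N`
equally spaced points of the unit circle; it is negative on the side of the centre. -/
noncomputable def chordDist (N n : ℕ) (b : ℤ) (w : ℂ) : ℝ :=
  w.re * Real.cos (chordAngle N n b) + w.im * Real.sin (chordAngle N n b) -
    Real.cos (2 * Real.pi * n / N)

theorem chordDist_polar (N n : ℕ) (b : ℤ) {w : ℂ} {r θ : ℝ} (hre : w.re = r * Real.cos θ)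
    (him : w.im = r * Real.sin θ) :
    chordDist N n b w = r * Real.cos (θ - chordAngle N n b) - Real.cos (2 * Real.pi * n / N) := by
  rw [chordDist, hre, him, Real.cos_sub]
  ring

theorem chordDist_add_mul {N : ℕ} (hN : 0 < N) (n : ℕ) (b k : ℤ) (w : ℂ) :
    chordDist N n (b + N * k) w = chordDist N n b w := by
  have hN' : (N : ℝ) ≠ 0 := by exact_mod_cast hN.ne'
  have h : chordAngle N n (b + N * k) = chordAngle N n b + k * (2 * Real.pi) := by
    simp only [chordAngle]
    push_cast
    field_simp
    ring
  rw [chordDist, chordDist, h, Real.cos_add_int_mul_two_pi, Real.sin_add_int_mul_two_pi]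

theorem chordDist_emod {N : ℕ} (hN : 0 < N) (n : ℕ) (b : ℤ) (w : ℂ) :
    chordDist N n (b % N) w = chordDist N n b w := by
  conv_rhs => rw [← Int.emod_add_mul_ediv b N]
  rw [chordDist_add_mul hN]

theorem continuous_chordDist (N n : ℕ) (b : ℤ) : Continuous (chordDist N n b) := by
  unfold chordDist
  fun_prop

theorem mem_segment_affine_iff {c ρ : ℂ} (hρ : ρ ≠ 0) {w x y : ℂ} :
    c + ρ * w ∈ segment ℝ (c + ρ * x) (c + ρ * y) ↔ w ∈ segment ℝ x y := by
  constructor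
  · rintro ⟨α, β, hα, hβ, h, heq⟩
    refine ⟨α, β, hα, hβ, h, mul_left_cancel₀ hρ (add_left_cancel (a := c) ?_)⟩
    rw [← heq]
    have h' : (α : ℂ) = 1 - β := by rw [eq_sub_iff_add_eq]; exact_mod_cast h
    simp only [real_smul, h']
    ring
  · rintro ⟨α, β, hα, hβ, h, rfl⟩
    refine ⟨α, β, hα, hβ, h, ?_⟩
    have h' : (α : ℂ) = 1 - β := by rw [eq_sub_iff_add_eq]; exact_mod_cast h
    simp only [real_smul, h']
    ring

/-- In coordinates rotated by φ the chord is the line x = cos α cut by the disc, and the disc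
condition becomes |y| ≤ sin α. -/
theorem mem_unit_chord_iff {φ α : ℝ} (hα : 0 < Real.sin α) (w : ℂ) :
    w ∈ segment ℝ (Complex.exp ((φ - α : ℝ) * I)) (Complex.exp ((φ + α : ℝ) * I)) ↔
      w.re * Real.cos φ + w.im * Real.sin φ = Real.cos α ∧ ‖w‖ ≤ 1 := by
  have hφ := Real.sin_sq_add_cos_sq φ
  have hαsq := Real.sin_sq_add_cos_sq α
  constructor
  · intro hw
    constructor
    · obtain ⟨s, t, -, -, hst, rfl⟩ := hw
      simp only [add_re, add_im, real_smul, re_ofReal_mul, im_ofReal_mul, exp_ofReal_mul_I_re,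
        exp_ofReal_mul_I_im, Real.cos_add, Real.cos_sub, Real.sin_add, Real.sin_sub]
      linear_combination (s + t) * Real.cos α * hφ + Real.cos α * hst
    · have h1 : ∀ θ : ℝ, Complex.exp (θ * I) ∈ Metric.closedBall (0 : ℂ) 1 := fun θ => by
        rw [mem_closedBall_zero_iff, norm_exp_ofReal_mul_I]
      rw [← mem_closedBall_zero_iff]
      exact (convex_closedBall (0 : ℂ) 1).segment_subset (h1 _) (h1 _) hw
  · rintro ⟨h1, h2⟩
    set y := -w.re * Real.sin φ + w.im * Real.cos φ with hy
    have hnorm : w.re ^ 2 + w.im ^ 2 ≤ 1 := by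
      have h3 : ‖w‖ ^ 2 ≤ 1 := pow_le_one₀ (norm_nonneg w) h2
      rw [← normSq_eq_norm_sq, normSq_apply] at h3
      nlinarith
    have hy2 : y ^ 2 ≤ Real.sin α ^ 2 := by
      have h3 : Real.cos α ^ 2 + y ^ 2 = w.re ^ 2 + w.im ^ 2 := by
        rw [← h1, hy]
        linear_combination (w.re ^ 2 + w.im ^ 2) * hφ
      linarith
    obtain ⟨hy3, hy4⟩ := abs_le_of_sq_le_sq' hy2 hα.le
    have h5 : -1 ≤ y / Real.sin α := by rw [le_div_iff₀ hα]; linarith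
    have h6 : y / Real.sin α ≤ 1 := by rw [div_le_one hα]; exact hy4
    refine ⟨(1 - y / Real.sin α) / 2, (1 + y / Real.sin α) / 2, by linarith, by linarith,
      by ring, ?_⟩
    have hre : w.re = Real.cos α * Real.cos φ - y * Real.sin φ := by
      rw [← h1, hy]; linear_combination (-w.re) * hφ
    have him : w.im = Real.cos α * Real.sin φ + y * Real.cos φ := by
      rw [← h1, hy]; linear_combination (-w.im) * hφ
    apply Complex.ext
    · rw [hre]
      simp only [add_re, real_smul, re_ofReal_mul, exp_ofReal_mul_I_re, Real.cos_add,
        Real.cos_sub]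
      field_simp
      ring
    · rw [him]
      simp only [add_im, real_smul, im_ofReal_mul, exp_ofReal_mul_I_im, Real.sin_add,
        Real.sin_sub]
      field_simp
      ring

theorem circlePoint_add_mul (c ρ : ℂ) {N : ℕ} (hN : 0 < N) (j k : ℕ) :
    circlePoint c ρ N (j + N * k) = circlePoint c ρ N j := by
  have hN' : (N : ℂ) ≠ 0 := by exact_mod_cast hN.ne'
  rw [circlePoint, circlePoint]
  have h : 2 * (Real.pi : ℂ) * I * (((j + N * k : ℕ) : ℂ) / N) =
      2 * Real.pi * I * (j / N) + k * (2 * Real.pi * I) := by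
    push_cast
    field_simp
  rw [h, Complex.exp_add, Complex.exp_nat_mul_two_pi_mul_I, mul_one]

theorem chord_angle_bounds {m n : ℕ} (hm : 5 ≤ m) (hn : 1 ≤ n) :
    0 < 2 * Real.pi * n / (m * n : ℕ) ∧ 2 * Real.pi * n / (m * n : ℕ) < Real.pi / 2 := by
  have hm' : (5 : ℝ) ≤ m := by exact_mod_cast hm
  have hn' : (1 : ℝ) ≤ n := by exact_mod_cast hn
  have hπ := Real.pi_pos
  have : 2 * Real.pi * n / (m * n : ℕ) = 2 * Real.pi / m := by
    push_cast; field_simp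
  rw [this]
  refine ⟨by positivity, ?_⟩
  rw [div_lt_iff₀ (by linarith)]
  nlinarith

theorem cos_chord_angle_pos {m n : ℕ} (hm : 5 ≤ m) (hn : 1 ≤ n) :
    0 < Real.cos (2 * Real.pi * n / (m * n : ℕ)) := by
  obtain ⟨h1, h2⟩ := chord_angle_bounds hm hn
  exact Real.cos_pos_of_mem_Ioo ⟨by linarith [Real.pi_pos], h2⟩

theorem mem_chord_iff {m n : ℕ} (hm : 5 ≤ m) (hn : 1 ≤ n) {c ρ : ℂ} (hρ : ρ ≠ 0) (b : ℕ) (w : ℂ) :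
    c + ρ * w ∈ segment ℝ (circlePoint c ρ (m * n) b) (circlePoint c ρ (m * n) (b + 2 * n)) ↔
      chordDist (m * n) n b w = 0 ∧ ‖w‖ ≤ 1 := by
  obtain ⟨h1, h2⟩ := chord_angle_bounds hm hn
  have hsin : 0 < Real.sin (2 * Real.pi * n / (m * n : ℕ)) :=
    Real.sin_pos_of_pos_of_lt_pi h1 (by linarith [Real.pi_pos])
  rw [circlePoint_eq, circlePoint_eq, mem_segment_affine_iff hρ, chordDist, sub_eq_zero,
    ← mem_unit_chord_iff hsin]
  have e1 : chordAngle (m * n) n b - 2 * Real.pi * n / (m * n : ℕ) =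
      2 * Real.pi * (b / (m * n : ℕ)) := by
    simp only [chordAngle]; push_cast; ring
  have e2 : chordAngle (m * n) n b + 2 * Real.pi * n / (m * n : ℕ) =
      2 * Real.pi * ((b + 2 * n : ℕ) / (m * n : ℕ)) := by
    simp only [chordAngle]; push_cast; ring
  rw [e1, e2]

/-- Chords may be indexed by all integers: the index matters only modulo m * n, and its residue
modulo n tells the star. -/
theorem mem_circleStars_iff {m n : ℕ} [NeZero m] (hm : 5 ≤ m) (hn : 1 ≤ n) {c ρ : ℂ} (hρ : ρ ≠ 0)
    (k : Fin n) (w : ℂ) :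
    c + ρ * w ∈ circleStars m c ρ n k ↔
      ∃ b : ℤ, b % n = k ∧ chordDist (m * n) n b w = 0 ∧ ‖w‖ ≤ 1 := by
  have hN : 0 < m * n := Nat.mul_pos (by omega) hn
  have hstep : ∀ j : Fin m, circlePoint c ρ (m * n) (k + n * (j + 2 : Fin m)) =
      circlePoint c ρ (m * n) (k + n * j + 2 * n) := by
    intro j
    have h1 : ((j + 2 : Fin m) : ℕ) = (j + 2) % m := by
      rw [Fin.val_add]
      congr 2
      exact Nat.mod_eq_of_lt (show 2 < m by omega)
    -- When j + 2 wraps around in `Fin m`, the point number changes by a multiple of m * n.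
    have h2 : k + n * j + 2 * n = (k + n * (j + 2 : Fin m)) + m * n * ((j + 2) / m) := by
      rw [h1]
      have := Nat.mod_add_div ((j : ℕ) + 2) m
      calc k + n * (j : ℕ) + 2 * n = k + n * ((j : ℕ) + 2) := by ring
        _ = k + n * (((j : ℕ) + 2) % m + m * (((j : ℕ) + 2) / m)) := by rw [this]
        _ = _ := by ring
    rw [h2, circlePoint_add_mul c ρ hN]
  simp only [circleStars, star, mem_iUnion, hstep, mem_chord_iff hm hn hρ]
  constructor
  · rintro ⟨j, hj⟩
    refine ⟨_, ?_, hj⟩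
    push_cast
    rw [Int.add_mul_emod_self_left]
    exact Int.emod_eq_of_lt (by omega) (by have := k.2; omega)
  · rintro ⟨b, hbk, hb⟩
    have hNZ : (0 : ℤ) < (m * n : ℕ) := by exact_mod_cast hN
    have hb0 : 0 ≤ b % (m * n : ℕ) := Int.emod_nonneg _ hNZ.ne'
    have hb1 : b % (m * n : ℕ) < (m * n : ℕ) := Int.emod_lt_of_pos _ hNZ
    obtain ⟨r, hr⟩ := Int.eq_ofNat_of_zero_le hb0
    have hrk : r % n = k := by
      have h3 : (r : ℤ) % n = k := by
        rw [← hr, Int.emod_emod_of_dvd, hbk]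
        exact ⟨m, by push_cast; ring⟩
      exact_mod_cast h3
    have hrlt : r < n * m := by
      rw [hr] at hb1
      rw [mul_comm n m]
      exact_mod_cast hb1
    refine ⟨⟨r / n, Nat.div_lt_of_lt_mul hrlt⟩, ?_⟩
    have h4 : (((k : ℕ) + n * (r / n) : ℕ) : ℤ) = b % (m * n : ℕ) := by
      rw [hr, ← hrk, Nat.mod_add_div]
    simp only [h4]
    rwa [chordDist_emod hN]

theorem mem_iUnion_circleStars_iff {m n : ℕ} [NeZero m] (hm : 5 ≤ m) (hn : 1 ≤ n) {c ρ : ℂ}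
    (hρ : ρ ≠ 0) (w : ℂ) :
    c + ρ * w ∈ ⋃ k, circleStars m c ρ n k ↔ ∃ b : ℤ, chordDist (m * n) n b w = 0 ∧ ‖w‖ ≤ 1 := by
  simp only [mem_iUnion, mem_circleStars_iff hm hn hρ]
  constructor
  · rintro ⟨k, b, -, hb⟩
    exact ⟨b, hb⟩
  · rintro ⟨b, hb⟩
    have hn0 : (0 : ℤ) < n := by exact_mod_cast hn
    have hb0 : 0 ≤ b % n := Int.emod_nonneg _ hn0.ne'
    have hb1 : b % n < n := Int.emod_lt_of_pos _ hn0
    obtain ⟨r, hr⟩ := Int.eq_ofNat_of_zero_le hb0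
    exact ⟨⟨r, by omega⟩, b, hr, hb⟩

theorem circleStars_eq_star_regular {m n : ℕ} [NeZero m] (hn : 1 ≤ n) (c : ℂ) {ρ : ℂ} (hρ : ρ ≠ 0)
    (k : Fin n) : ∃ p : Fin m → ℂ, IsRegularPolygon p ∧ circleStars m c ρ n k = star p := by
  refine ⟨_, ⟨c, ρ * Complex.exp (2 * Real.pi * I * (k / (m * n : ℕ))),
    mul_ne_zero hρ (Complex.exp_ne_zero _), fun j => ?_⟩, rfl⟩
  have hm : (m : ℂ) ≠ 0 := by exact_mod_cast NeZero.ne m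
  have hn' : (n : ℂ) ≠ 0 := by exact_mod_cast (by omega : n ≠ 0)
  rw [circlePoint, circlePoint, mul_assoc ρ, ← Complex.exp_add]
  congr 3
  push_cast
  field_simp

/-! ### The regions of the stars on equally spaced points -/

/-- A set of integers which contains `2 * n` consecutive ones. -/
def HasLongRun (n : ℕ) (A : Set ℤ) : Prop := ∃ b₀ : ℤ, ∀ i : ℤ, 0 ≤ i → i < 2 * n → b₀ + i ∈ A

/-- The chords which separate `w` from the centre. -/
def separating (N n : ℕ) (w : ℂ) : Set ℤ := {b | 0 < chordDist N n b w}

/-- From outside the disc, a chord separates w from the centre as soon as its direction is within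
2πn/N of that of w. This condition puts the index in an interval of length 2n, which contains 2n
consecutive integers. -/
theorem hasLongRun_separating {m n : ℕ} (hm : 5 ≤ m) (hn : 1 ≤ n) {w : ℂ} (hw : 1 < ‖w‖) :
    HasLongRun n (separating (m * n) n w) := by
  have hN : (0 : ℝ) < (m * n : ℕ) := by exact_mod_cast Nat.mul_pos (by omega : 0 < m) hn
  obtain ⟨h1, h2⟩ := chord_angle_bounds hm hn
  have hcos := cos_chord_angle_pos hm hn
  have hπ := Real.pi_pos
  set N := m * n
  set θ := arg w
  -- x is the fractional number of the circle point in the direction of w; the indices in [x - 2n,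
  -- x] serve.
  set x : ℝ := θ * N / (2 * Real.pi) with hx
  have hθ : θ = 2 * Real.pi * x / N := by rw [hx]; field_simp
  refine ⟨⌈x - 2 * n⌉, fun i hi0 hi1 => ?_⟩
  have hi0' : (0 : ℝ) ≤ i := by exact_mod_cast hi0
  have hi1' : (i : ℝ) ≤ 2 * n - 1 := by
    have : i ≤ 2 * n - 1 := by omega
    exact_mod_cast this
  have hc1 := Int.le_ceil (x - 2 * n)
  have hc2 := Int.ceil_lt_add_one (x - 2 * n)
  simp only [separating, mem_ofPred_eq]
  rw [chordDist_polar N n _ (Complex.norm_mul_cos_arg w).symm (Complex.norm_mul_sin_arg w).symm]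
  set b := ⌈x - 2 * n⌉ + i with hb
  have hb' : (b : ℝ) = ⌈x - 2 * n⌉ + i := by rw [hb]; push_cast; ring
  have hang : θ - chordAngle N n b = 2 * Real.pi * (x - (b + n)) / N := by
    rw [hθ, chordAngle]; ring
  have habs : |θ - chordAngle N n b| ≤ 2 * Real.pi * n / N := by
    rw [hang, abs_div, abs_mul, abs_of_pos hN, abs_of_pos (by positivity : (0 : ℝ) < 2 * Real.pi)]
    gcongr
    rw [abs_le]
    constructor <;> linarith
  have hge : Real.cos (2 * Real.pi * n / N) ≤ Real.cos (θ - chordAngle N n b) := by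
    rw [← Real.cos_abs (θ - chordAngle N n b)]
    exact Real.cos_le_cos_of_nonneg_of_le_pi (abs_nonneg _) (by linarith) habs
  change 0 < ‖w‖ * Real.cos (θ - chordAngle N n b) - _
  nlinarith

open Classical in
/-- The chords which separate a point from the centre, or all chords if these are too many. -/
noncomputable def regionLabel (N n : ℕ) (w : ℂ) : Set ℤ :=
  if HasLongRun n (separating N n w) then univ else separating N n w

theorem regionLabel_of_one_lt_norm {m n : ℕ} (hm : 5 ≤ m) (hn : 1 ≤ n) {w : ℂ} (hw : 1 < ‖w‖) :
    regionLabel (m * n) n w = univ :=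
  if_pos (hasLongRun_separating hm hn hw)

theorem eventually_separating_eq {N n : ℕ} (hN : 0 < N) {w : ℂ} (hw : ∀ b, chordDist N n b w ≠ 0) :
    ∀ᶠ y in 𝓝 w, separating N n y = separating N n w := by
  have h : ∀ᶠ y in 𝓝 w, ∀ b ∈ Finset.Ico (0 : ℤ) N,
      (0 < chordDist N n b y ↔ 0 < chordDist N n b w) := by
    rw [Finset.eventually_all]
    intro b _
    have hc := (continuous_chordDist N n b).continuousAt (x := w)
    rcases (hw b).lt_or_gt with h | h
    · filter_upwards [hc.eventually (gt_mem_nhds h)] with y hy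
      exact ⟨fun h' => absurd h' hy.not_gt, fun h' => absurd h' h.not_gt⟩
    · filter_upwards [hc.eventually (lt_mem_nhds h)] with y hy
      exact ⟨fun _ => h, fun _ => hy⟩
  filter_upwards [h] with y hy
  ext b
  have hNZ : (0 : ℤ) < N := by exact_mod_cast hN
  have := hy (b % N) (Finset.mem_Ico.2 ⟨Int.emod_nonneg _ hNZ.ne', Int.emod_lt_of_pos _ hNZ⟩)
  rwa [chordDist_emod hN, chordDist_emod hN] at this

/-- Off the stars a point can still lie on the extension of a chord, where `separating` jumps. Such
a point is outside the disc, and there the label is constantly `univ`. -/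
theorem regionLabel_eventually_eq {m n : ℕ} (hm : 5 ≤ m) (hn : 1 ≤ n) {w : ℂ}
    (hw : ¬∃ b : ℤ, chordDist (m * n) n b w = 0 ∧ ‖w‖ ≤ 1) :
    ∀ᶠ y in 𝓝 w, regionLabel (m * n) n y = regionLabel (m * n) n w := by
  by_cases h : ∃ b, chordDist (m * n) n b w = 0
  · obtain ⟨b, hb⟩ := h
    have hnorm : 1 < ‖w‖ := by
      by_contra! hle
      exact hw ⟨b, hb, hle⟩
    filter_upwards [continuous_norm.continuousAt.eventually (lt_mem_nhds hnorm)] with y hy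
    rw [regionLabel_of_one_lt_norm hm hn hy, regionLabel_of_one_lt_norm hm hn hnorm]
  · push Not at h
    filter_upwards [eventually_separating_eq (Nat.mul_pos (by omega) hn) h] with y hy
    rw [regionLabel, regionLabel, hy]

theorem isLocallyConstant_regionLabel {m n : ℕ} [NeZero m] (hm : 5 ≤ m) (hn : 1 ≤ n) {c ρ : ℂ}
    (hρ : ρ ≠ 0) : IsLocallyConstant fun z : ↥((⋃ k, circleStars m c ρ n k)ᶜ : Set ℂ) =>
      regionLabel (m * n) n ((z.1 - c) / ρ) := by
  rw [IsLocallyConstant.iff_eventually_eq]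
  rintro ⟨z, hz⟩
  have hcont : Continuous fun z : ↥((⋃ k, circleStars m c ρ n k)ᶜ : Set ℂ) =>
      (z.1 - c) / ρ := by fun_prop
  refine hcont.continuousAt.eventually (regionLabel_eventually_eq hm hn ?_)
  rw [← mem_iUnion_circleStars_iff hm hn hρ]
  simp only
  rwa [mul_div_cancel₀ _ hρ, add_sub_cancel]

/-- A locally constant label is constant on components, so different labels certify different
regions. -/
theorem le_numRegions_of_labels {m n : ℕ} [NeZero m] (hm : 5 ≤ m) (hn : 1 ≤ n) {c ρ : ℂ}
    (hρ : ρ ≠ 0) {ι : Type*} (x : ι → ℂ)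
    (hx : ∀ i, ¬∃ b : ℤ, chordDist (m * n) n b (x i) = 0 ∧ ‖x i‖ ≤ 1)
    (hinj : Function.Injective fun i => regionLabel (m * n) n (x i)) :
    ENat.card ι ≤ numRegions (circleStars m c ρ n) := by
  have hmem : ∀ i, c + ρ * x i ∈ (⋃ k, circleStars m c ρ n k)ᶜ := fun i => by
    rw [mem_compl_iff, mem_iUnion_circleStars_iff hm hn hρ]
    exact hx i
  refine ENat.card_le_card_of_injective (f := fun i =>
    ConnectedComponents.mk (⟨c + ρ * x i, hmem i⟩ : ↥((⋃ k, circleStars m c ρ n k)ᶜ : Set ℂ))) ?_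
  intro i j hij
  apply hinj
  have h := (isLocallyConstant_regionLabel hm hn (c := c) hρ).apply_eq_of_isPreconnected
    isPreconnected_connectedComponent (ConnectedComponents.coe_eq_coe'.1 hij) mem_connectedComponent
  simpa [mul_div_cancel_left₀ _ hρ] using h

/-- The point where the chords `b` and `b + l` meet if `t = 2 * b + l`, and a point midway between
such crossings if `t + l` is odd. -/
noncomputable def gridPoint (N n l : ℕ) (t : ℤ) : ℂ :=
  (Real.cos (2 * Real.pi * n / N) / Real.cos (Real.pi * l / N) : ℝ) *
    Complex.exp ((Real.pi * (2 * n + t) / N : ℝ) * I)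

theorem chordDist_gridPoint (N n l : ℕ) (t b : ℤ) :
    chordDist N n b (gridPoint N n l t) = Real.cos (2 * Real.pi * n / N) /
      Real.cos (Real.pi * l / N) * Real.cos (Real.pi * (t - 2 * b : ℤ) / N) -
        Real.cos (2 * Real.pi * n / N) := by
  rw [chordDist_polar N n b (r := Real.cos (2 * Real.pi * n / N) / Real.cos (Real.pi * l / N))
    (θ := Real.pi * (2 * n + t) / N)]
  · congr 3
    rw [chordAngle]
    push_cast
    ring
  · rw [gridPoint, re_ofReal_mul, exp_ofReal_mul_I_re]
  · rw [gridPoint, im_ofReal_mul, exp_ofReal_mul_I_im]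

theorem grid_angle_bounds {m n l : ℕ} (hm : 5 ≤ m) (hn : 1 ≤ n) (hl : l < 2 * n) :
    Real.pi * l / (m * n : ℕ) < 2 * Real.pi * n / (m * n : ℕ) ∧
      0 < Real.cos (Real.pi * l / (m * n : ℕ)) := by
  obtain ⟨h1, h2⟩ := chord_angle_bounds hm hn
  have hπ := Real.pi_pos
  have hN : (0 : ℝ) < (m * n : ℕ) := by exact_mod_cast Nat.mul_pos (by omega : 0 < m) hn
  have hl' : (l : ℝ) < 2 * n := by exact_mod_cast hl
  have h3 : Real.pi * l / (m * n : ℕ) < 2 * Real.pi * n / (m * n : ℕ) :=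
    (div_lt_div_iff_of_pos_right hN).2 (by nlinarith)
  have h4 : 0 ≤ Real.pi * l / (m * n : ℕ) := by positivity
  exact ⟨h3, Real.cos_pos_of_mem_Ioo ⟨by linarith, by linarith⟩⟩

theorem chordDist_gridPoint_sign {m n l : ℕ} (hm : 5 ≤ m) (hn : 1 ≤ n) (hl : l < 2 * n)
    (t b : ℤ) :
    (0 < chordDist (m * n) n b (gridPoint (m * n) n l t) ↔
      Real.cos (Real.pi * l / (m * n : ℕ)) <
        Real.cos (Real.pi * (t - 2 * b : ℤ) / (m * n : ℕ))) ∧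
    (chordDist (m * n) n b (gridPoint (m * n) n l t) = 0 ↔
      Real.cos (Real.pi * l / (m * n : ℕ)) =
        Real.cos (Real.pi * (t - 2 * b : ℤ) / (m * n : ℕ))) := by
  have h1 := (grid_angle_bounds hm hn hl).2
  have h2 := cos_chord_angle_pos hm hn
  rw [chordDist_gridPoint]
  set C := Real.cos (2 * Real.pi * n / (m * n : ℕ))
  set D := Real.cos (Real.pi * l / (m * n : ℕ))
  set X := Real.cos (Real.pi * (t - 2 * b : ℤ) / (m * n : ℕ))
  have : C / D * X - C = C / D * (X - D) := by field_simp
  rw [this]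
  have hCD : 0 < C / D := div_pos h2 h1
  refine ⟨?_, ?_⟩
  · rw [mul_pos_iff_of_pos_left hCD, sub_pos]
  · rw [mul_eq_zero, or_iff_right hCD.ne', sub_eq_zero, eq_comm]

/-- The residues of `b - a` modulo `N` are less than `l`. -/
def arc (N : ℕ) (a : ℤ) (l : ℕ) : Set ℤ := {b | (b - a) % N < l}

/-- The point lies in the mean direction of the chords a, ..., a + l - 1, at the radius where chords
at angular offset πl/N would be met. The offset of chord a + r is π(2r + 1 - l)/N, below this
threshold in absolute value for 0 ≤ r < l, beyond it modulo 2π for l ≤ r < N; by parity it is never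
equal. -/
theorem separating_gridPoint {m n l : ℕ} (hm : 5 ≤ m) (hn : 1 ≤ n) (hl0 : 1 ≤ l) (hl : l < 2 * n)
    (a : ℤ) :
    separating (m * n) n (gridPoint (m * n) n l (2 * a + l - 1)) = arc (m * n) a l ∧
      ∀ b, chordDist (m * n) n b (gridPoint (m * n) n l (2 * a + l - 1)) ≠ 0 := by
  have hN : (0 : ℝ) < (m * n : ℕ) := by exact_mod_cast Nat.mul_pos (by omega : 0 < m) hn
  have hNZ : (0 : ℤ) < (m * n : ℕ) := by exact_mod_cast Nat.mul_pos (by omega : 0 < m) hn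
  have hπ := Real.pi_pos
  obtain ⟨h1, -⟩ := grid_angle_bounds hm hn hl
  obtain ⟨-, h2⟩ := chord_angle_bounds hm hn
  have key : ∀ b : ℤ, ((b - a) % (m * n : ℕ) < l ∧ Real.cos (Real.pi * l / (m * n : ℕ)) <
      Real.cos (Real.pi * (2 * a + l - 1 - 2 * b : ℤ) / (m * n : ℕ))) ∨
      (¬(b - a) % (m * n : ℕ) < l ∧ Real.cos (Real.pi * (2 * a + l - 1 - 2 * b : ℤ) / (m * n : ℕ)) <
        Real.cos (Real.pi * l / (m * n : ℕ))) := by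
    intro b
    have hr0 := Int.emod_nonneg (b - a) hNZ.ne'
    have hr1 := Int.emod_lt_of_pos (b - a) hNZ
    have hdecomp := Int.emod_add_mul_ediv (b - a) (m * n : ℕ)
    set N := m * n
    set r := (b - a) % (N : ℤ)
    set q := (b - a) / (N : ℤ)
    have hcos : Real.cos (Real.pi * (2 * a + l - 1 - 2 * b : ℤ) / N) =
        Real.cos (Real.pi * (2 * r + 1 - l : ℤ) / N) := by
      have e1 : Real.pi * (2 * a + l - 1 - 2 * b : ℤ) / N =
          -(Real.pi * (2 * r + 1 - l : ℤ) / N + q * (2 * Real.pi)) := by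
        have e2 : 2 * a + l - 1 - 2 * b = -(2 * r + 1 - l) - 2 * (N * q) := by linarith
        rw [e2]
        push_cast
        field_simp
        ring
      rw [e1, Real.cos_neg, Real.cos_add_int_mul_two_pi]
    rw [hcos]
    by_cases hrl : r < l
    · refine Or.inl ⟨hrl, ?_⟩
      rw [← Real.cos_abs (Real.pi * (2 * r + 1 - l : ℤ) / N)]
      refine Real.cos_lt_cos_of_nonneg_of_le_pi (abs_nonneg _) (by linarith) ?_
      rw [abs_div, abs_mul, abs_of_pos hN, abs_of_pos hπ]
      gcongr
      have : |2 * r + 1 - (l : ℤ)| < l := by rw [abs_lt]; constructor <;> omega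
      exact_mod_cast this
    · refine Or.inr ⟨hrl, ?_⟩
      have hu1 : (l : ℝ) + 1 ≤ (2 * r + 1 - l : ℤ) := by
        have : (l : ℤ) + 1 ≤ 2 * r + 1 - l := by omega
        exact_mod_cast this
      have hu2 : ((2 * r + 1 - l : ℤ) : ℝ) ≤ 2 * N - l - 1 := by
        have : 2 * r + 1 - l ≤ 2 * (N : ℤ) - l - 1 := by omega
        exact_mod_cast this
      set u : ℝ := ((2 * r + 1 - l : ℤ) : ℝ)
      rcases le_total (Real.pi * u / N) Real.pi with hle | hle
      · refine Real.cos_lt_cos_of_nonneg_of_le_pi (by positivity) hle ?_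
        gcongr
        linarith
      -- Offsets beyond π are reflected to [0, π], where cosine decreases.
      · have hrefl : Real.cos (Real.pi * u / N) = Real.cos (2 * Real.pi - Real.pi * u / N) :=
          (Real.cos_two_pi_sub _).symm
        rw [hrefl]
        refine Real.cos_lt_cos_of_nonneg_of_le_pi (by positivity) (by linarith) ?_
        have : 2 * Real.pi - Real.pi * u / N = Real.pi * (2 * N - u) / N := by field_simp
        rw [this]
        gcongr
        linarith
  constructor
  · ext b
    change 0 < chordDist _ _ _ _ ↔ (b - a) % _ < _
    rw [(chordDist_gridPoint_sign hm hn hl _ b).1]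
    rcases key b with h | h
    · exact iff_of_true h.2 h.1
    · exact iff_of_false h.2.not_gt h.1
  · intro b hb
    rw [(chordDist_gridPoint_sign hm hn hl _ b).2] at hb
    rcases key b with h | h
    · exact h.2.ne hb
    · exact h.2.ne' hb

/-- A run starting at residue r < l would reach residue l after l - r < 2n steps, and l is outside
the arc. -/
theorem not_hasLongRun_arc {N n l : ℕ} (hl : l < 2 * n) (hlN : l < N) (a : ℤ) :
    ¬HasLongRun n (arc N a l) := by
  rintro ⟨b₀, h⟩
  have hNZ : (0 : ℤ) < N := by omega
  have h0 : (b₀ + 0 - a) % N < l := h 0 le_rfl (by omega)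
  rw [add_zero] at h0
  have hr0 := Int.emod_nonneg (b₀ - a) hNZ.ne'
  have h1 : (b₀ + (l - (b₀ - a) % N) - a) % N < l := h _ (by omega) (by omega)
  have h2 : b₀ + (l - (b₀ - a) % N) - a = l + N * ((b₀ - a) / N) := by
    have := Int.emod_add_mul_ediv (b₀ - a) N
    linarith
  rw [h2, Int.add_mul_emod_self_left, Int.emod_eq_of_lt (by omega) (by omega)] at h1
  exact lt_irrefl _ h1

theorem mem_arc_self {N l : ℕ} (a : ℤ) (hl : 1 ≤ l) : a ∈ arc N a l := by
  simp [arc]; omega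

/-- If a and a' differ, the residues of a - a' and a' - a sum to N; but they would be below l' and
l, with l + l' < N. Hence the starting points agree, and then so do the lengths. -/
theorem arc_injective {N : ℕ} {a a' : ℤ} {l l' : ℕ} (ha : 0 ≤ a ∧ a < N) (ha' : 0 ≤ a' ∧ a' < N)
    (hl : 1 ≤ l) (hl' : 1 ≤ l') (hlN : 2 * l < N) (hlN' : 2 * l' < N)
    (h : arc N a l = arc N a' l') : a = a' ∧ l = l' := by
  have h1 : (a - a') % N < l' := (h ▸ mem_arc_self a hl : a ∈ arc N a' l')
  have h2 : (a' - a) % N < l := (h ▸ mem_arc_self a' hl' : a' ∈ arc N a l)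
  have haa : a = a' := by
    rcases lt_trichotomy a a' with hlt | heq | hlt
    · have e1 : (a - a') % N = a - a' + N := by
        rw [← Int.add_emod_right]
        exact Int.emod_eq_of_lt (by omega) (by omega)
      have e2 : (a' - a) % N = a' - a := Int.emod_eq_of_lt (by omega) (by omega)
      omega
    · exact heq
    · have e1 : (a' - a) % N = a' - a + N := by
        rw [← Int.add_emod_right]
        exact Int.emod_eq_of_lt (by omega) (by omega)
      have e2 : (a - a') % N = a - a' := Int.emod_eq_of_lt (by omega) (by omega)
      omega
  refine ⟨haa, ?_⟩
  subst haa
  have h3 : ∀ i : ℕ, i < N → (i < l ↔ i < l') := by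
    intro i hi
    have h4 : ∀ l : ℕ, a + i ∈ arc N a l ↔ i < l := by
      intro l
      change (a + i - a) % N < l ↔ _
      rw [add_sub_cancel_left, Int.emod_eq_of_lt (by omega) (by omega)]
      omega
    rw [← h4, ← h4, h]
  have h5 := h3 l (by omega)
  have h6 := h3 l' (by omega)
  omega

theorem le_numRegions_circleStars {m n : ℕ} [NeZero m] (hm : 5 ≤ m) (hn : 1 ≤ n) (c : ℂ) {ρ : ℂ}
    (hρ : ρ ≠ 0) :
    ((m * n * (2 * n - 1) + 2 : ℕ) : ℕ∞) ≤ numRegions (circleStars m c ρ n) := by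
  have hNn : 5 * n ≤ m * n := Nat.mul_le_mul_right n hm
  have hcos := cos_chord_angle_pos hm hn
  set x : Option (Option (Fin (m * n) × Fin (2 * n - 1))) → ℂ := fun o =>
    match o with
    | none => 2
    | some none => 0
    | some (some (a, l)) => gridPoint (m * n) n (l + 1) (2 * (a : ℕ) + (l + 1 : ℕ) - 1) with hx
  have hgrid : ∀ (a : Fin (m * n)) (l : Fin (2 * n - 1)), regionLabel (m * n) n
      (gridPoint (m * n) n (l + 1) (2 * (a : ℕ) + (l + 1 : ℕ) - 1)) =
        arc (m * n) (a : ℕ) (l + 1) := by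
    intro a l
    have hl := l.2
    rw [regionLabel, (separating_gridPoint hm hn (by omega) (by omega) _).1, if_neg]
    exact not_hasLongRun_arc (by omega) (by omega) _
  have hsep0 : separating (m * n) n 0 = ∅ := by
    ext b
    simpa [separating, chordDist] using hcos.le
  have hzero : regionLabel (m * n) n 0 = ∅ := by
    rw [regionLabel, hsep0, if_neg]
    rintro ⟨b, hb⟩
    exact hb 0 le_rfl (by omega)
  have htwo : regionLabel (m * n) n 2 = univ := regionLabel_of_one_lt_norm hm hn (by norm_num)
  have huniv : ∀ (a : Fin (m * n)) (l : Fin (2 * n - 1)), arc (m * n) (a : ℕ) (l + 1) ≠ univ := by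
    intro a l h
    have hl := l.2
    refine not_hasLongRun_arc (N := m * n) (n := n) (l := l + 1) (by omega) (by omega) (a : ℕ) ?_
    rw [h]
    exact ⟨0, fun _ _ _ => mem_univ _⟩
  have hempty : ∀ (a : Fin (m * n)) (l : Fin (2 * n - 1)), arc (m * n) (a : ℕ) (l + 1) ≠ ∅ :=
    fun a l => Nonempty.ne_empty ⟨_, mem_arc_self _ (by omega)⟩
  have hmain := le_numRegions_of_labels hm hn (c := c) hρ x (by
    rintro (_ | _ | ⟨a, l⟩) ⟨b, hb, hb'⟩
    · norm_num [hx] at hb'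
    · simp only [hx, chordDist, zero_re, zero_im, zero_mul, zero_add, zero_sub] at hb
      linarith
    · have hl := l.2
      exact (separating_gridPoint hm hn (by omega) (by omega) _).2 b hb) (by
    rintro (_ | _ | ⟨a, l⟩) (_ | _ | ⟨a', l'⟩) h
    · rfl
    · simp only [hx, hzero, htwo] at h
      exact absurd h univ_nonempty.ne_empty
    · simp only [hx, hgrid, htwo] at h
      exact absurd h.symm (huniv _ _)
    · simp only [hx, hzero, htwo] at h
      exact absurd h.symm univ_nonempty.ne_empty
    · rfl
    · simp only [hx, hgrid, hzero] at h
      exact absurd h.symm (hempty _ _)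
    · simp only [hx, hgrid, htwo] at h
      exact absurd h (huniv _ _)
    · simp only [hx, hgrid, hzero] at h
      exact absurd h (hempty _ _)
    · simp only [hx, hgrid] at h
      have hl := l.2
      have hl' := l'.2
      have ha := a.2
      have ha' := a'.2
      obtain ⟨h1, h2⟩ := arc_injective ⟨by omega, by omega⟩ ⟨by omega, by omega⟩ (by omega)
        (by omega) (by omega) (by omega) h
      have h3 : a = a' := Fin.ext (by exact_mod_cast h1)
      have h4 : l = l' := Fin.ext (by omega)
      rw [h3, h4])
  refine le_trans (le_of_eq ?_) hmain
  rw [ENat.card_eq_coe_fintype_card]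
  simp [add_assoc, one_add_one_eq_two]

/-! ### The crossings of two of the pentagrams -/

/-- Two chord lines fail to meet in one point only if their normals are parallel. Equal normals
force b ≡ b' modulo n; opposite normals give two distinct parallel lines, since their distance from
the centre is positive. -/
theorem chordDist_eq_zero_subsingleton {m n : ℕ} (hm : 5 ≤ m) (hn : 1 ≤ n) {b b' : ℤ}
    (hb : b % n ≠ b' % n) :
    {w : ℂ | chordDist (m * n) n b w = 0 ∧ chordDist (m * n) n b' w = 0}.Subsingleton := by
  have hN : ((m * n : ℕ) : ℝ) ≠ 0 := by exact_mod_cast (Nat.mul_pos (by omega : 0 < m) hn).ne'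
  have hcos := cos_chord_angle_pos hm hn
  rintro w ⟨h1, h2⟩ w' ⟨h1', h2'⟩
  simp only [chordDist] at h1 h2 h1' h2'
  set C := Real.cos (2 * Real.pi * n / (m * n : ℕ))
  by_cases hs : Real.sin (chordAngle (m * n) n b' - chordAngle (m * n) n b) = 0
  · exfalso
    obtain ⟨k, hk⟩ := Real.sin_eq_zero_iff.1 hs
    have hk' : (k : ℝ) * (m * n : ℕ) = 2 * (b' - b) := by
      have h3 : chordAngle (m * n) n b' - chordAngle (m * n) n b =
          2 * (b' - b) / (m * n : ℕ) * Real.pi := by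
        simp only [chordAngle]; ring
      rw [h3] at hk
      have h4 := mul_right_cancel₀ Real.pi_ne_zero hk
      rw [h4]
      field_simp
    have hkZ : k * (m * n : ℕ) = 2 * (b' - b) := by exact_mod_cast hk'
    have hang : chordAngle (m * n) n b' = chordAngle (m * n) n b + k * Real.pi := by linarith
    rcases Int.even_or_odd' k with ⟨q, rfl | rfl⟩
    · apply hb
      have h5 : b' = b + n * (q * m) := by
        push_cast at hkZ
        linarith
      rw [h5, Int.add_mul_emod_self_left]
    · have e1 : Real.cos (chordAngle (m * n) n b') = -Real.cos (chordAngle (m * n) n b) := by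
        rw [hang, show chordAngle (m * n) n b + ((2 * q + 1 : ℤ) : ℝ) * Real.pi =
          (chordAngle (m * n) n b + Real.pi) + q * (2 * Real.pi) by push_cast; ring,
          Real.cos_add_int_mul_two_pi, Real.cos_add_pi]
      have e2 : Real.sin (chordAngle (m * n) n b') = -Real.sin (chordAngle (m * n) n b) := by
        rw [hang, show chordAngle (m * n) n b + ((2 * q + 1 : ℤ) : ℝ) * Real.pi =
          (chordAngle (m * n) n b + Real.pi) + q * (2 * Real.pi) by push_cast; ring,
          Real.sin_add_int_mul_two_pi, Real.sin_add_pi]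
      rw [e1, e2] at h2
      linarith
  · rw [Real.sin_sub] at hs
    apply Complex.ext
    · apply mul_right_cancel₀ hs
      linear_combination Real.sin (chordAngle (m * n) n b') * (h1 - h1') -
        Real.sin (chordAngle (m * n) n b) * (h2 - h2')
    · apply mul_right_cancel₀ hs
      linear_combination Real.cos (chordAngle (m * n) n b) * (h2 - h2') -
        Real.cos (chordAngle (m * n) n b') * (h1 - h1')

theorem circleStars_inter_finite {m n : ℕ} [NeZero m] (hm : 5 ≤ m) (hn : 1 ≤ n) (c : ℂ) {ρ : ℂ}
    (hρ : ρ ≠ 0) {k l : Fin n} (hkl : k ≠ l) :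
    (circleStars m c ρ n k ∩ circleStars m c ρ n l).Finite := by
  have hNpos : 0 < m * n := Nat.mul_pos (by omega : 0 < m) hn
  have hNZ : (0 : ℤ) < (m * n : ℕ) := by exact_mod_cast hNpos
  set N := m * n with hNdef
  have hfin : (⋃ q ∈ ((Finset.Ico (0 : ℤ) N ×ˢ Finset.Ico (0 : ℤ) N).filter
      fun q => q.1 % (n : ℤ) ≠ q.2 % (n : ℤ)), (fun w : ℂ => c + ρ * w) ''
        {w : ℂ | chordDist N n q.1 w = 0 ∧ chordDist N n q.2 w = 0}).Finite := by
    refine Set.Finite.biUnion (Finset.finite_toSet _) fun q hq => Set.Finite.image _ ?_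
    exact (chordDist_eq_zero_subsingleton hm hn (Finset.mem_filter.1 hq).2).finite
  refine hfin.subset ?_
  rintro z ⟨hzk, hzl⟩
  obtain ⟨w, rfl⟩ : ∃ w, z = c + ρ * w := ⟨(z - c) / ρ, by field_simp; ring⟩
  obtain ⟨b, hb, hbw, -⟩ := (mem_circleStars_iff hm hn hρ k w).1 hzk
  obtain ⟨b', hb', hbw', -⟩ := (mem_circleStars_iff hm hn hρ l w).1 hzl
  have hmod : ∀ b : ℤ, b % (N : ℤ) % n = b % n := fun b =>
    Int.emod_emod_of_dvd b ⟨m, by rw [hNdef]; push_cast; ring⟩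
  simp only [mem_iUnion]
  refine ⟨(b % N, b' % N), Finset.mem_filter.2 ⟨Finset.mem_product.2
    ⟨Finset.mem_Ico.2 ⟨Int.emod_nonneg _ hNZ.ne', Int.emod_lt_of_pos _ hNZ⟩,
      Finset.mem_Ico.2 ⟨Int.emod_nonneg _ hNZ.ne', Int.emod_lt_of_pos _ hNZ⟩⟩, ?_⟩,
    w, ⟨?_, ?_⟩, rfl⟩
  · simp only
    rw [hmod, hmod, hb, hb']
    intro h
    exact hkl (Fin.ext (by exact_mod_cast h))
  · simp only; rw [chordDist_emod hNpos, hbw]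
  · simp only; rw [chordDist_emod hNpos, hbw']

theorem gridPoint_mem_chords {m n d : ℕ} (hm : 5 ≤ m) (hn : 1 ≤ n) (hd : d < 2 * n) (a : ℤ) :
    chordDist (m * n) n a (gridPoint (m * n) n d (2 * a + d)) = 0 ∧
      chordDist (m * n) n (a + d) (gridPoint (m * n) n d (2 * a + d)) = 0 ∧
      ‖gridPoint (m * n) n d (2 * a + d)‖ ≤ 1 := by
  refine ⟨?_, ?_, ?_⟩
  · rw [(chordDist_gridPoint_sign hm hn hd _ _).2, add_sub_cancel_left, Int.cast_natCast]
  · rw [(chordDist_gridPoint_sign hm hn hd _ _).2,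
      show 2 * a + d - 2 * (a + d) = -(d : ℤ) by ring]
    push_cast
    rw [mul_neg, neg_div, Real.cos_neg]
  · obtain ⟨h1, h2⟩ := grid_angle_bounds hm hn hd
    have h3 := cos_chord_angle_pos hm hn
    obtain ⟨-, h4⟩ := chord_angle_bounds hm hn
    have hπ := Real.pi_pos
    rw [gridPoint, norm_mul, norm_exp_ofReal_mul_I, norm_real, Real.norm_eq_abs,
      abs_of_pos (div_pos h3 h2), mul_one, div_le_one h2]
    exact Real.cos_le_cos_of_nonneg_of_le_pi (by positivity) (by linarith) h1.le

/-- The modulus of the point determines d, and then its argument determines a modulo N. -/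
theorem gridPoint_injective {m n d d' : ℕ} (hm : 5 ≤ m) (hn : 1 ≤ n) (hd : d < 2 * n)
    (hd' : d' < 2 * n) {a a' : ℤ} (ha : 0 ≤ a ∧ a < (m * n : ℕ)) (ha' : 0 ≤ a' ∧ a' < (m * n : ℕ))
    (h : gridPoint (m * n) n d (2 * a + d) = gridPoint (m * n) n d' (2 * a' + d')) :
    a = a' ∧ d = d' := by
  obtain ⟨h1, h2⟩ := grid_angle_bounds hm hn hd
  obtain ⟨h1', h2'⟩ := grid_angle_bounds hm hn hd'
  have h3 := cos_chord_angle_pos hm hn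
  obtain ⟨-, h4⟩ := chord_angle_bounds hm hn
  have hπ := Real.pi_pos
  have hN : (0 : ℝ) < (m * n : ℕ) := by exact_mod_cast Nat.mul_pos (by omega : 0 < m) hn
  simp only [gridPoint] at h
  set N := m * n
  set C := Real.cos (2 * Real.pi * n / N)
  have hnorm := congrArg norm h
  rw [norm_mul, norm_exp_ofReal_mul_I, norm_real, Real.norm_eq_abs, abs_of_pos (div_pos h3 h2),
    norm_mul, norm_exp_ofReal_mul_I, norm_real, Real.norm_eq_abs, abs_of_pos (div_pos h3 h2'),
    mul_one, mul_one] at hnorm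
  have hcos : Real.cos (Real.pi * d / N) = Real.cos (Real.pi * d' / N) := by
    rw [div_eq_div_iff h2.ne' h2'.ne'] at hnorm
    exact (mul_left_cancel₀ h3.ne' hnorm).symm
  have hdd : d = d' := by
    have h5 := Real.injOn_cos ⟨by positivity, by linarith⟩ ⟨by positivity, by linarith⟩ hcos
    field_simp at h5
    exact_mod_cast h5
  subst hdd
  refine ⟨?_, rfl⟩
  have hne : ((C / Real.cos (Real.pi * d / N) : ℝ) : ℂ) ≠ 0 := by
    exact_mod_cast (div_pos h3 h2).ne'
  obtain ⟨k, hk⟩ := Complex.exp_eq_exp_iff_exists_int.1 (mul_left_cancel₀ hne h)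
  have hk' : Real.pi * (2 * n + (2 * a + d : ℤ)) / N =
      Real.pi * (2 * n + (2 * a' + d : ℤ)) / N + k * (2 * Real.pi) := by
    have h6 := congrArg Complex.im hk
    simpa using h6
  push_cast at hk'
  field_simp at hk'
  have h7 : (a : ℝ) = a' + k * N := by linarith
  have h8 : a = a' + k * N := by exact_mod_cast h7
  have h9 : k = 0 := by
    by_contra hk0
    rcases lt_or_gt_of_ne hk0 with hlt | hgt
    · nlinarith
    · nlinarith
  rw [h8, h9]
  ring

/-- Chords a and a + d with d < 2n cross inside the disc. The `Bool` decides which star owns chord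
a, the `Fin 5` counts its five chords, and the `Fin 2` the two values d < 2n of the right residue
modulo n: 2 · 5 · 2 = 20 distinct crossings. -/
theorem twenty_le_encard_inter {n : ℕ} (hn : 1 ≤ n) (c : ℂ) {ρ : ℂ} (hρ : ρ ≠ 0) {k l : Fin n}
    (hkl : k < l) : 20 ≤ (circleStars 5 c ρ n k ∩ circleStars 5 c ρ n l).encard := by
  have hkl' : (k : ℕ) < l := hkl
  have hln := l.2
  set A : Bool × Fin 2 × Fin 5 → ℕ := fun i => (bif i.1 then (l : ℕ) else k) + n * i.2.2 with hA
  set D : Bool × Fin 2 × Fin 5 → ℕ :=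
    fun i => (bif i.1 then n - (l - k) else (l : ℕ) - k) + n * i.2.1 with hD
  have hAlt : ∀ i, A i < 5 * n := by
    rintro ⟨s, e, j⟩
    have hj : n * (j : ℕ) ≤ n * 4 := Nat.mul_le_mul_left n (by omega)
    cases s <;> simp only [hA, cond_true, cond_false] <;> omega
  have hDlt : ∀ i, D i < 2 * n := by
    rintro ⟨s, e, j⟩
    have he : n * (e : ℕ) ≤ n * 1 := Nat.mul_le_mul_left n (by omega)
    cases s <;> simp only [hD, cond_true, cond_false] <;> omega
  set q : Bool × Fin 2 × Fin 5 → ℂ := fun i =>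
    c + ρ * gridPoint (5 * n) n (D i) (2 * (A i : ℕ) + (D i : ℕ)) with hq
  have hinj : Function.Injective q := by
    rintro ⟨s, e, j⟩ ⟨s', e', j'⟩ h
    obtain ⟨h1, h2⟩ := gridPoint_injective (m := 5) le_rfl hn (hDlt _) (hDlt _)
      ⟨by omega, by exact_mod_cast hAlt _⟩ ⟨by omega, by exact_mod_cast hAlt _⟩
      (mul_left_cancel₀ hρ (add_left_cancel h))
    have h1' : A (s, e, j) = A (s', e', j') := by exact_mod_cast h1
    have hmod : ∀ (x y : ℕ) , x < n → (x + n * y) % n = x := fun x y hx => by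
      rw [Nat.add_mul_mod_self_left, Nat.mod_eq_of_lt hx]
    have hss : s = s' := by
      have h3 := congrArg (· % n) h1'
      cases s <;> cases s' <;> simp only [hA, cond_true, cond_false] at h3 ⊢ <;>
        rw [hmod _ _ (by omega), hmod _ _ (by omega)] at h3 <;> omega
    subst hss
    have hj : j = j' := Fin.ext (Nat.eq_of_mul_eq_mul_left hn (Nat.add_left_cancel h1'))
    have he : e = e' := Fin.ext (Nat.eq_of_mul_eq_mul_left hn (Nat.add_left_cancel h2))
    rw [hj, he]
  have hsub : range q ⊆ circleStars 5 c ρ n k ∩ circleStars 5 c ρ n l := by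
    rintro _ ⟨i, rfl⟩
    obtain ⟨h1, h2, h3⟩ := gridPoint_mem_chords (m := 5) le_rfl hn (hDlt i) (A i : ℕ)
    have hmod : ∀ (x y : ℕ), x < n → (((x + n * y : ℕ) : ℤ)) % n = x := fun x y hx => by
      push_cast
      rw [Int.add_mul_emod_self_left]
      exact Int.emod_eq_of_lt (by omega) (by omega)
    have hq1 : ∀ (r : Fin n) (b : ℤ), b % n = r → chordDist (5 * n) n b
        (gridPoint (5 * n) n (D i) (2 * (A i : ℕ) + (D i : ℕ))) = 0 →
          q i ∈ circleStars 5 c ρ n r := fun r b hb h0 =>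
      (mem_circleStars_iff le_rfl hn hρ r _).2 ⟨b, hb, h0, h3⟩
    obtain ⟨s, e, j⟩ := i
    cases s
    · refine ⟨hq1 k _ (hmod k j (by omega)) h1, hq1 l _ ?_ h2⟩
      have : A (false, e, j) + D (false, e, j) = l + n * (j + e) := by
        simp only [hA, hD, cond_false]
        rw [mul_add]; omega
      rw [← Nat.cast_add, this]
      exact hmod l _ hln
    · refine ⟨hq1 k _ ?_ h2, hq1 l _ (hmod l j hln) h1⟩
      have : A (true, e, j) + D (true, e, j) = k + n * (j + e + 1) := by
        simp only [hA, hD, cond_true]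
        rw [mul_add, mul_add]; omega
      rw [← Nat.cast_add, this]
      exact hmod k _ (by omega)
  refine le_trans (le_of_eq ?_) (encard_le_encard hsub)
  rw [← image_univ, hinj.injOn.encard_image, encard_univ, ENat.card_eq_coe_fintype_card]
  simp

theorem circleStars_inter_encard {n : ℕ} (hn : 1 ≤ n) (c : ℂ) {ρ : ℂ} (hρ : ρ ≠ 0) {k l : Fin n}
    (hkl : k ≠ l) : (circleStars 5 c ρ n k ∩ circleStars 5 c ρ n l).encard = 20 := by
  have hpent : ∀ k, IsPentagram (circleStars 5 c ρ n k) := fun k =>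
    IsRegularPentagram.isPentagram (circleStars_eq_star_regular hn c hρ k)
  refine le_antisymm (pentagram_inter_encard_le (hpent k) (hpent l)
    (circleStars_inter_finite le_rfl hn c hρ hkl)) ?_
  rcases lt_or_gt_of_ne hkl with h | h
  · exact twenty_le_encard_inter hn c hρ h
  · rw [inter_comm]
    exact twenty_le_encard_inter hn c hρ h

/-! ### The maximum numbers of regions -/

theorem numRegions_pentagrams_le {n : ℕ} (hn : 1 ≤ n) {S : Fin n → Set ℂ}
    (hS : ∀ i, IsPentagram (S i)) : numRegions S ≤ ((10 * n ^ 2 - 5 * n + 2 : ℕ) : ℕ∞) :=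
  (pentagrams_bound n S hS).2.2.2 hn

theorem numRegions_hexagrams_le {n : ℕ} (hn : 1 ≤ n) {S : Fin n → Set ℂ}
    (hS : ∀ i, IsHexagram (S i)) :
    numRegions S ≤ ((2 * (6 * n ^ 2 - 3 * n + 1) : ℕ) : ℕ∞) :=
  (hexagrams_bound n S hS).2.2.2 hn

theorem circleStars_five_isRegularPentagram {n : ℕ} (hn : 1 ≤ n) (c : ℂ) {ρ : ℂ} (hρ : ρ ≠ 0)
    (k : Fin n) : IsRegularPentagram (circleStars 5 c ρ n k) :=
  circleStars_eq_star_regular hn c hρ k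

theorem circleStars_six_isRegularHexagram {n : ℕ} (hn : 1 ≤ n) (c : ℂ) {ρ : ℂ} (hρ : ρ ≠ 0)
    (k : Fin n) : IsRegularHexagram (circleStars 6 c ρ n k) :=
  circleStars_eq_star_regular hn c hρ k

theorem numRegions_circleStars_five {n : ℕ} (hn : 1 ≤ n) (c : ℂ) {ρ : ℂ} (hρ : ρ ≠ 0) :
    numRegions (circleStars 5 c ρ n) = ((10 * n ^ 2 - 5 * n + 2 : ℕ) : ℕ∞) := by
  refine le_antisymm (numRegions_pentagrams_le hn fun k =>
    (circleStars_five_isRegularPentagram hn c hρ k).isPentagram) ?_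
  have h : 10 * n ^ 2 - 5 * n + 2 = 5 * n * (2 * n - 1) + 2 := by
    zify [show 5 * n ≤ 10 * n ^ 2 by nlinarith, show 1 ≤ 2 * n by omega]
    ring
  rw [h]
  exact le_numRegions_circleStars (m := 5) le_rfl hn c hρ

theorem numRegions_circleStars_six {n : ℕ} (hn : 1 ≤ n) (c : ℂ) {ρ : ℂ} (hρ : ρ ≠ 0) :
    numRegions (circleStars 6 c ρ n) = ((2 * (6 * n ^ 2 - 3 * n + 1) : ℕ) : ℕ∞) := by
  refine le_antisymm (numRegions_hexagrams_le hn fun k =>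
    (circleStars_six_isRegularHexagram hn c hρ k).isHexagram) ?_
  have h : 2 * (6 * n ^ 2 - 3 * n + 1) = 6 * n * (2 * n - 1) + 2 := by
    zify [show 3 * n ≤ 6 * n ^ 2 by nlinarith, show 1 ≤ 2 * n by omega]
    ring
  rw [h]
  exact le_numRegions_circleStars (m := 6) (by norm_num) hn c hρ

end StarRegions

theorem mainTheorem10 :
    -- every pentagram has exactly five self-crossings
    (∀ p : Fin 5 → ℂ, StarRegions.IsConvexPolygon p →
      (StarRegions.selfCrossings p).encard = 5) ∧
    -- two pentagrams without overlapping segments meet in at most twenty points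
    (∀ P Q : Set ℂ, StarRegions.IsPentagram P → StarRegions.IsPentagram Q →
      (P ∩ Q).Finite → (P ∩ Q).encard ≤ 20) ∧
    -- the maximum number of regions for `n` pentagrams, arbitrary ones or regular ones
    -- (the subtraction never truncates)
    (∀ n : ℕ, 1 ≤ n →
      IsGreatest (StarRegions.regionCounts StarRegions.IsPentagram n)
        ((10 * n ^ 2 - 5 * n + 2 : ℕ) : ℕ∞) ∧
      IsGreatest (StarRegions.regionCounts StarRegions.IsRegularPentagram n)
        ((10 * n ^ 2 - 5 * n + 2 : ℕ) : ℕ∞)) ∧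
    -- the same for hexagrams (the subtraction never truncates)
    (∀ n : ℕ, 1 ≤ n →
      IsGreatest (StarRegions.regionCounts StarRegions.IsHexagram n)
        ((2 * (6 * n ^ 2 - 3 * n + 1) : ℕ) : ℕ∞) ∧
      IsGreatest (StarRegions.regionCounts StarRegions.IsRegularHexagram n)
        ((2 * (6 * n ^ 2 - 3 * n + 1) : ℕ) : ℕ∞)) ∧
    -- the stars on `5 * n`, respectively `6 * n`, equally spaced points of any circle are regular
    -- and attain the bounds
    (∀ (c ρ : ℂ) (n : ℕ), ρ ≠ 0 → 1 ≤ n →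
      ((∀ k, StarRegions.IsRegularPentagram (StarRegions.circleStars 5 c ρ n k)) ∧
        (∀ k l, k ≠ l → (StarRegions.circleStars 5 c ρ n k ∩
          StarRegions.circleStars 5 c ρ n l).encard = 20) ∧
        StarRegions.numRegions (StarRegions.circleStars 5 c ρ n) =
          ((10 * n ^ 2 - 5 * n + 2 : ℕ) : ℕ∞)) ∧
      ((∀ k, StarRegions.IsRegularHexagram (StarRegions.circleStars 6 c ρ n k)) ∧
        StarRegions.numRegions (StarRegions.circleStars 6 c ρ n) =
          ((2 * (6 * n ^ 2 - 3 * n + 1) : ℕ) : ℕ∞))) := by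
  refine ⟨fun p hp => StarRegions.selfCrossings_encard hp,
    fun P Q hP hQ h => StarRegions.pentagram_inter_encard_le hP hQ h, fun n hn => ?_,
    fun n hn => ?_, fun c ρ n hρ hn => ?_⟩
  · have hreg := StarRegions.circleStars_five_isRegularPentagram hn 0 one_ne_zero
    have hnum := StarRegions.numRegions_circleStars_five hn 0 one_ne_zero
    refine ⟨⟨⟨_, fun k => (hreg k).isPentagram, hnum.symm⟩, ?_⟩, ⟨⟨_, hreg, hnum.symm⟩, ?_⟩⟩
    · rintro _ ⟨S, hS, rfl⟩
      exact StarRegions.numRegions_pentagrams_le hn hS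
    · rintro _ ⟨S, hS, rfl⟩
      exact StarRegions.numRegions_pentagrams_le hn fun k => (hS k).isPentagram
  · have hreg := StarRegions.circleStars_six_isRegularHexagram hn 0 one_ne_zero
    have hnum := StarRegions.numRegions_circleStars_six hn 0 one_ne_zero
    refine ⟨⟨⟨_, fun k => (hreg k).isHexagram, hnum.symm⟩, ?_⟩, ⟨⟨_, hreg, hnum.symm⟩, ?_⟩⟩
    · rintro _ ⟨S, hS, rfl⟩
      exact StarRegions.numRegions_hexagrams_le hn hS
    · rintro _ ⟨S, hS, rfl⟩
      exact StarRegions.numRegions_hexagrams_le hn fun k => (hS k).isHexagram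
  · exact ⟨⟨StarRegions.circleStars_five_isRegularPentagram hn c hρ,
      fun k l hkl => StarRegions.circleStars_inter_encard hn c hρ hkl,
      StarRegions.numRegions_circleStars_five hn c hρ⟩,
      StarRegions.circleStars_six_isRegularHexagram hn c hρ,
      StarRegions.numRegions_circleStars_six hn c hρ⟩
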